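/- Let $?:[0,1]\to[0,1]$ be the Minkowski question mark function, i.e. the continuous function with $?(0)=0$, $?(1)=1$ and $?\left(\frac{p+p'}{q+q'}\right)=\frac12\left(?\left(\frac pq\right)+?\left(\frac{p'}{q'}\right)\right)$ whenever $\frac pq<\frac{p'}{q'}$ are consecutive elements of one of the Stern--Brocot sequences $F_n$, where $F_0=\left\{\frac01,\frac11\right\}$ and $F_{n+1}$ is obtained from $F_n$ by inserting the mediants of all pairs of consecutive elements. For an irrational $x\in(0,1)$ with regular continued fraction $x=[0;a_1,a_2,\dots]$ put $S_x(t)=a_1+\dots+a_t$ ($t=1,2,\dots$), and let $\kappa_1=\frac{2\log\frac{1+\sqrt5}{2}}{\log 2}$. The derivative $?'(x)$ is understood in the extended sense: it exists if $\frac{?(y)-?(x)}{y-x}$ has a finite or infinite limit as $y\to x$, and is then equal to this limit. (i) Let $x\in(0,1)$ be irrational, and suppose that there is a constant $C$ such that for all natural numbers $t\ge1$ $$S_x(t)\le\kappa_1t+\frac{\log t}{\log 2}+C.$$ Then $?'(x)$ exists and $?'(x)=+\infty$. (ii) Let $\psi$ be a (not necessarily strictly) increasing real function on the positive integers with $\lim_{t\to+\infty}\psi(t)=+\infty$.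 Then there exists an irrational number $x\in(0,1)$ such that $?'(x)$ does not exist (neither as a finite nor as an infinite limit) and $$S_x(t)\le\kappa_1t+\frac{\log t}{\log 2}+\psi(t)$$ for all sufficiently large $t$; if moreover $\psi(1)\ge1-\kappa_1$ (in particular if $\psi\ge0$), then $x$ can be chosen so that this inequality holds for every $t\ge1$. -/

import Mathlib

namespace MinkowskiQM

/-- The Stern-Brocot sequences: `sternBrocot n j = (p, q)`, where `p / q` is the `j`-th element
(`0 ≤ j ≤ 2 ^ n`, in increasing order) of `F_n`. Here `F_0 = {0/1, 1/1}`, and `F_(n+1)` is obtained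
from `F_n` by inserting the mediant of each pair of consecutive elements. -/
def sternBrocot : ℕ → ℕ → ℕ × ℕ
  | 0, j => if j = 0 then (0, 1) else (1, 1)
  | n + 1, j =>
      if j % 2 = 0 then sternBrocot n (j / 2)
      else ((sternBrocot n (j / 2)).1 + (sternBrocot n (j / 2 + 1)).1,
            (sternBrocot n (j / 2)).2 + (sternBrocot n (j / 2 + 1)).2)

/-- The `j`-th element of `F_n` as a real number. -/
noncomputable def sternBrocotPoint (n j : ℕ) : ℝ :=
  ((sternBrocot n j).1 : ℝ) / ((sternBrocot n j).2 : ℝ)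

/-- The Minkowski question mark function. The mediant rule together with `?(0) = 0`, `?(1) = 1`
forces the value `j / 2 ^ n` at the `j`-th element of `F_n`; this is extended to `[0, 1]` by taking
suprema from the left, which is the extension by continuity (see `questionMark_sternBrocotPoint`,
`questionMark_mediant` and `continuous_questionMark` below). -/
noncomputable def questionMark (x : ℝ) : ℝ :=
  sSup {y : ℝ | ∃ n j : ℕ, j ≤ 2 ^ n ∧ sternBrocotPoint n j ≤ x ∧ y = (j : ℝ) / 2 ^ n}

/-- `a_(i+1)(x)`, the partial quotient of index `i + 1` in the regular continued fraction
`x = [a_0; a_1, a_2, …]` (zero if the expansion stops earlier). -/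
noncomputable def partialQuotient (x : ℝ) (i : ℕ) : ℝ :=
  ((GenContFract.of x).partDens.get? i).getD 0

/-- `S_x(t) = a_1 + ⋯ + a_t`. -/
noncomputable def partialQuotientSum (x : ℝ) (t : ℕ) : ℝ :=
  ∑ i ∈ Finset.range t, partialQuotient x i

/-- `κ₁ = 2 log ((1 + √5) / 2) / log 2`. -/
noncomputable def kappaOne : ℝ :=
  2 * Real.log ((1 + Real.sqrt 5) / 2) / Real.log 2

/-- `f` has at `x` the derivative `L`, where the values `±∞` are allowed: the difference quotients
`(f y - f x) / (y - x)` tend to `L` in the extended reals as `y → x`, `y ≠ x`. -/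
def HasExtDerivAt (f : ℝ → ℝ) (L : EReal) (x : ℝ) : Prop :=
  Filter.Tendsto (fun y : ℝ => (((f y - f x) / (y - x) : ℝ) : EReal))
    (nhdsWithin x {x}ᶜ) (nhds L)

lemma sternBrocot_even (n j : ℕ) : sternBrocot (n + 1) (2 * j) = sternBrocot n j := by
  simp [sternBrocot]

lemma sternBrocot_odd (n j : ℕ) : sternBrocot (n + 1) (2 * j + 1) =
    ((sternBrocot n j).1 + (sternBrocot n (j + 1)).1,
      (sternBrocot n j).2 + (sternBrocot n (j + 1)).2) := by
  have h : (2 * j + 1) / 2 = j := by omega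
  have h2 : (2 * j + 1) % 2 = 1 := by omega
  simp [sternBrocot, h, h2]

lemma sternBrocot_den_pos (n j : ℕ) : 0 < (sternBrocot n j).2 := by
  induction n generalizing j with
  | zero => unfold sternBrocot; split_ifs <;> simp
  | succ n ih =>
    unfold sternBrocot
    split_ifs
    · exact ih _
    · exact Nat.add_pos_left (ih _) _

lemma sternBrocot_det (n j : ℕ) (hj : j < 2 ^ n) :
    (sternBrocot n (j + 1)).1 * (sternBrocot n j).2 =
      (sternBrocot n j).1 * (sternBrocot n (j + 1)).2 + 1 := by
  induction n generalizing j with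
  | zero =>
    have : j = 0 := by simpa using hj
    subst this
    simp [sternBrocot]
  | succ n ih =>
    rw [pow_succ] at hj
    rcases Nat.even_or_odd' j with ⟨k, rfl | rfl⟩
    · have := ih k (by omega)
      rw [sternBrocot_even, sternBrocot_odd]
      simp only
      nlinarith
    · have := ih k (by omega)
      rw [show 2 * k + 1 + 1 = 2 * (k + 1) by ring, sternBrocot_even, sternBrocot_odd]
      simp only
      nlinarith

lemma sternBrocotPoint_succ_sub (n j : ℕ) (hj : j < 2 ^ n) :
    sternBrocotPoint n (j + 1) - sternBrocotPoint n j =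
      1 / ((sternBrocot n j).2 * (sternBrocot n (j + 1)).2 : ℝ) := by
  have h1 : (0 : ℝ) < (sternBrocot n j).2 := by exact_mod_cast sternBrocot_den_pos n j
  have h2 : (0 : ℝ) < (sternBrocot n (j + 1)).2 := by
    exact_mod_cast sternBrocot_den_pos n (j + 1)
  have h3 : ((sternBrocot n (j + 1)).1 : ℝ) * (sternBrocot n j).2 =
      (sternBrocot n j).1 * (sternBrocot n (j + 1)).2 + 1 := by
    exact_mod_cast sternBrocot_det n j hj
  unfold sternBrocotPoint
  field_simp
  linarith

lemma sternBrocotPoint_lt_succ (n j : ℕ) (hj : j < 2 ^ n) :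
    sternBrocotPoint n j < sternBrocotPoint n (j + 1) := by
  have h1 : (0 : ℝ) < (sternBrocot n j).2 := by exact_mod_cast sternBrocot_den_pos n j
  have h2 : (0 : ℝ) < (sternBrocot n (j + 1)).2 := by
    exact_mod_cast sternBrocot_den_pos n (j + 1)
  have h3 := sternBrocotPoint_succ_sub n j hj
  have h4 : 0 < 1 / ((sternBrocot n j).2 * (sternBrocot n (j + 1)).2 : ℝ) := by positivity
  linarith

lemma sternBrocotPoint_lt (n : ℕ) {i j : ℕ} (hij : i < j) (hj : j ≤ 2 ^ n) :
    sternBrocotPoint n i < sternBrocotPoint n j := by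
  induction j, hij using Nat.le_induction with
  | base => exact sternBrocotPoint_lt_succ n i hj
  | succ k hk ih =>
    exact (ih (by omega)).trans (sternBrocotPoint_lt_succ n k hj)

lemma sternBrocot_refine (n k j : ℕ) : sternBrocot (n + k) (2 ^ k * j) = sternBrocot n j := by
  induction k with
  | zero => simp
  | succ k ih =>
    rw [← add_assoc, pow_succ, mul_comm (2 ^ k) 2, mul_assoc, sternBrocot_even, ih]

lemma div_le_of_sternBrocotPoint_le {m i n j : ℕ} (hi : i ≤ 2 ^ m)
    (h : sternBrocotPoint m i ≤ sternBrocotPoint n j) :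
    (i : ℝ) / 2 ^ m ≤ (j : ℝ) / 2 ^ n := by
  have e1 : sternBrocotPoint (m + n) (2 ^ n * i) = sternBrocotPoint m i := by
    unfold sternBrocotPoint; rw [sternBrocot_refine]
  have e2 : sternBrocotPoint (m + n) (2 ^ m * j) = sternBrocotPoint n j := by
    unfold sternBrocotPoint; rw [add_comm m n, sternBrocot_refine]
  have key : 2 ^ n * i ≤ 2 ^ m * j := by
    by_contra! hlt
    have := sternBrocotPoint_lt (m + n) hlt (by
      rw [pow_add, mul_comm (2 ^ m)]; exact Nat.mul_le_mul_left _ hi)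
    rw [e1, e2] at this
    linarith
  have key' : (2 : ℝ) ^ n * i ≤ 2 ^ m * j := by exact_mod_cast key
  rw [div_le_div_iff₀ (by positivity) (by positivity)]
  linarith

/-- The value of `?` at the `j`-th element of `F_n`. -/
theorem questionMark_sternBrocotPoint (n j : ℕ) (hj : j ≤ 2 ^ n) :
    questionMark (sternBrocotPoint n j) = (j : ℝ) / 2 ^ n := by
  apply IsGreatest.csSup_eq
  refine ⟨⟨n, j, hj, le_rfl, rfl⟩, ?_⟩
  rintro y ⟨m, i, hi, h, rfl⟩
  exact div_le_of_sternBrocotPoint_le hi h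

lemma sternBrocotPoint_zero (n : ℕ) : sternBrocotPoint n 0 = 0 := by
  have := sternBrocot_refine 0 n 0
  simp only [zero_add, mul_zero] at this
  simp [sternBrocotPoint, this, sternBrocot]

lemma sternBrocotPoint_last (n : ℕ) : sternBrocotPoint n (2 ^ n) = 1 := by
  have := sternBrocot_refine 0 n 1
  simp only [zero_add, mul_one] at this
  simp [sternBrocotPoint, this, sternBrocot]

theorem questionMark_zero : questionMark 0 = 0 := by
  have := questionMark_sternBrocotPoint 0 0 (by simp)
  rwa [sternBrocotPoint_zero, Nat.cast_zero, zero_div] at this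

theorem questionMark_one : questionMark 1 = 1 := by
  have := questionMark_sternBrocotPoint 0 (2 ^ 0) le_rfl
  rw [sternBrocotPoint_last] at this
  simpa using this

/-- The mediant rule for consecutive elements of `F_n`. -/
theorem questionMark_mediant (n j : ℕ) (hj : j < 2 ^ n) :
    questionMark ((((sternBrocot n j).1 + (sternBrocot n (j + 1)).1 : ℕ) : ℝ) /
        (((sternBrocot n j).2 + (sternBrocot n (j + 1)).2 : ℕ) : ℝ)) =
      (questionMark (sternBrocotPoint n j) + questionMark (sternBrocotPoint n (j + 1))) / 2 := by
  have h := questionMark_sternBrocotPoint (n + 1) (2 * j + 1) (by rw [pow_succ]; omega)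
  unfold sternBrocotPoint at h
  rw [sternBrocot_odd] at h
  rw [h, questionMark_sternBrocotPoint n j hj.le, questionMark_sternBrocotPoint n (j + 1) hj]
  push_cast
  field_simp
  ring

lemma questionMark_bddAbove (x : ℝ) :
    BddAbove {y : ℝ | ∃ n j : ℕ, j ≤ 2 ^ n ∧ sternBrocotPoint n j ≤ x ∧ y = (j : ℝ) / 2 ^ n} := by
  refine ⟨1, ?_⟩
  rintro y ⟨n, j, hj, -, rfl⟩
  rw [div_le_one (by positivity)]
  exact_mod_cast hj

theorem questionMark_monotone : Monotone questionMark := by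
  intro x y hxy
  rcases Set.eq_empty_or_nonempty
    {z : ℝ | ∃ n j : ℕ, j ≤ 2 ^ n ∧ sternBrocotPoint n j ≤ x ∧ z = (j : ℝ) / 2 ^ n} with h | h
  · unfold questionMark
    rw [h, Real.sSup_empty]
    apply Real.sSup_nonneg
    rintro z ⟨n, j, -, -, rfl⟩
    positivity
  · apply csSup_le_csSup (questionMark_bddAbove y) h
    rintro z ⟨n, j, hj, hz, rfl⟩
    exact ⟨n, j, hj, hz.trans hxy, rfl⟩

theorem questionMark_mem_Icc (x : ℝ) : questionMark x ∈ Set.Icc (0 : ℝ) 1 := by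
  constructor
  · apply Real.sSup_nonneg
    rintro z ⟨n, j, -, -, rfl⟩
    positivity
  · apply Real.sSup_le _ zero_le_one
    rintro y ⟨n, j, hj, -, rfl⟩
    rw [div_le_one (by positivity)]
    exact_mod_cast hj

theorem continuous_questionMark : Continuous questionMark := by
  -- between two values of `?` in `[0, 1]` there is a dyadic rational, which is again a value
  have key : ∀ u v : ℝ, 0 ≤ u → u < v → v ≤ 1 → ∃ z, u < questionMark z ∧ questionMark z < v := by
    intro u v hu huv hv
    obtain ⟨n, hn⟩ := exists_pow_lt_of_lt_one (sub_pos.2 huv) (show (1 / 2 : ℝ) < 1 by norm_num)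
    have h2 : (0 : ℝ) < 2 ^ n := by positivity
    rw [div_pow, one_pow, div_lt_iff₀ h2] at hn
    have hf := Nat.lt_floor_add_one (u * 2 ^ n)
    have hf' := Nat.floor_le (show 0 ≤ u * 2 ^ n by positivity)
    have hlt : ((⌊u * 2 ^ n⌋₊ + 1 : ℕ) : ℝ) < v * 2 ^ n := by push_cast; linarith
    have hle : ⌊u * 2 ^ n⌋₊ + 1 ≤ 2 ^ n := by
      have : ((⌊u * 2 ^ n⌋₊ + 1 : ℕ) : ℝ) ≤ ((2 ^ n : ℕ) : ℝ) := by
        push_cast at hlt ⊢; nlinarith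
      exact_mod_cast this
    refine ⟨sternBrocotPoint n (⌊u * 2 ^ n⌋₊ + 1), ?_⟩
    rw [questionMark_sternBrocotPoint _ _ hle, lt_div_iff₀ h2, div_lt_iff₀ h2]
    exact ⟨by push_cast; linarith, hlt⟩
  rw [continuous_iff_continuousAt]
  intro x
  rw [Metric.continuousAt_iff]
  intro ε hε
  have hx := questionMark_mem_Icc x
  have up : ∃ z, x < z ∧ questionMark z < questionMark x + ε := by
    by_cases h : questionMark x < 1
    · obtain ⟨z, hz1, hz2⟩ := key (questionMark x) (min 1 (questionMark x + ε)) hx.1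
        (lt_min h (by linarith)) (min_le_left _ _)
      refine ⟨z, ?_, hz2.trans_le (min_le_right _ _)⟩
      by_contra! hle
      exact absurd (questionMark_monotone hle) (not_le.2 hz1)
    · exact ⟨x + 1, by linarith, by linarith [(questionMark_mem_Icc (x + 1)).2]⟩
  have dn : ∃ z, z < x ∧ questionMark x - ε < questionMark z := by
    by_cases h : 0 < questionMark x
    · obtain ⟨z, hz1, hz2⟩ := key (max 0 (questionMark x - ε)) (questionMark x) (le_max_left _ _)
        (max_lt h (by linarith)) hx.2
      refine ⟨z, ?_, (le_max_right _ _).trans_lt hz1⟩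
      by_contra! hle
      exact absurd (questionMark_monotone hle) (not_le.2 hz2)
    · exact ⟨x - 1, by linarith, by linarith [(questionMark_mem_Icc (x - 1)).1]⟩
  obtain ⟨z1, hz1, hz1'⟩ := up
  obtain ⟨z2, hz2, hz2'⟩ := dn
  refine ⟨min (z1 - x) (x - z2), lt_min (by linarith) (by linarith), ?_⟩
  intro y hy
  rw [Real.dist_eq, abs_lt] at hy
  have a1 := min_le_left (z1 - x) (x - z2)
  have a2 := min_le_right (z1 - x) (x - z2)
  have b1 : questionMark y ≤ questionMark z1 := questionMark_monotone (by linarith)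
  have b2 : questionMark z2 ≤ questionMark y := questionMark_monotone (by linarith)
  rw [Real.dist_eq, abs_lt]
  constructor <;> linarith

end MinkowskiQM

/-! On a cell of `F_n` with end denominators q and q', `?` rises by 2^(-n) over the length 1/(qq'),
so its mean slope there is qq'/2^n. A difference quotient of `?` at an irrational x, taken close to
x, is at least a sixth of the slope over some deep cell of x (`exists_cellSlope_le`); conversely, an
extended derivative at x is the limit of these slopes (`HasExtDerivAt.tendsto_cellSlope`). Both
claims thus become statements about slopes over cells of x.

Let q_t be the denominator of [0; a_1, ..., a_t]. The cells of x come in runs, one per partial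
quotient, and the least slope in a run is the last, 2 q_t q_(t+1) / 2^S(t+1). Moreover 2^(κ₁ t) =
φ^(2t), where φ is the golden ratio.

(i) With E_t = S(t) - t one has q_t ≥ φ^(t-3) (1 + E_t) (`goldenRatio_pow_le_den`). If E is bounded,
φ² > 2 suffices. If not, the hypothesis makes 2^S(t+1) / (1 + E_(t+1)) at most a constant times
φ^(2t): one of the two factors 1 + E absorbs the term log t / log 2, and the other drives the slope
to infinity.

(ii) All partial quotients are 1 except at rare jumps, where S is raised to the integer part of the
allowed bound. Let P be the product of the partial quotients before a jump. A long string of ones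
makes the slope at least P/φ^6 just before the jump; since q_t ≤ φ^t P (`den_le_goldenRatio_pow`)
and 2^ψ beats any linear function of ψ, a late enough jump brings it down to at most 2/P. P at least
doubles at each jump, so the slopes accumulate at both 0 and ∞. -/

namespace MinkowskiQM

/-! ### Cells of the Stern–Brocot sequences and their slopes -/

/-- `x` lies in the `j`-th closed interval cut out by `F_n`. -/
def InCell (x : ℝ) (n j : ℕ) : Prop :=
  j < 2 ^ n ∧ sternBrocotPoint n j ≤ x ∧ x ≤ sternBrocotPoint n (j + 1)

/-- The slope of `?` over the `j`-th interval of `F_n`. -/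
noncomputable def cellSlope (n j : ℕ) : ℝ :=
  ((sternBrocot n j).2 * (sternBrocot n (j + 1)).2 : ℝ) / 2 ^ n

lemma sternBrocotPoint_refine (n k j : ℕ) :
    sternBrocotPoint (n + k) (2 ^ k * j) = sternBrocotPoint n j := by
  unfold sternBrocotPoint; rw [sternBrocot_refine]

lemma cellSlope_eq (n j : ℕ) (hj : j < 2 ^ n) :
    cellSlope n j = (questionMark (sternBrocotPoint n (j + 1)) -
      questionMark (sternBrocotPoint n j)) /
        (sternBrocotPoint n (j + 1) - sternBrocotPoint n j) := by
  have h1 : (0 : ℝ) < (sternBrocot n j).2 := by exact_mod_cast sternBrocot_den_pos n j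
  have h2 : (0 : ℝ) < (sternBrocot n (j + 1)).2 := by
    exact_mod_cast sternBrocot_den_pos n (j + 1)
  rw [sternBrocotPoint_succ_sub n j hj, questionMark_sternBrocotPoint n _ hj,
    questionMark_sternBrocotPoint n j hj.le, cellSlope]
  push_cast
  field_simp
  ring

/-- A point of `F_n` persists in all later sequences, and each refinement replaces its left
neighbour by the mediant of the two, which adds one more copy of the point. -/
lemma sternBrocot_run_left (n i c : ℕ) :
    sternBrocot (n + i) (2 ^ i * (c + 1) - 1) =
      ((sternBrocot n c).1 + i * (sternBrocot n (c + 1)).1,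
        (sternBrocot n c).2 + i * (sternBrocot n (c + 1)).2) := by
  induction i with
  | zero => simp
  | succ i ih =>
    have hp : 0 < 2 ^ i * (c + 1) := by positivity
    have e : 2 ^ (i + 1) * (c + 1) - 1 = 2 * (2 ^ i * (c + 1) - 1) + 1 := by
      rw [pow_succ, mul_comm (2 ^ i) 2, mul_assoc]; omega
    rw [e, ← add_assoc, sternBrocot_odd, ih, Nat.sub_add_cancel hp, sternBrocot_refine]
    ext <;> push_cast <;> ring

lemma sternBrocot_run_right (n i c : ℕ) :
    sternBrocot (n + i) (2 ^ i * c + 1) =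
      ((sternBrocot n (c + 1)).1 + i * (sternBrocot n c).1,
        (sternBrocot n (c + 1)).2 + i * (sternBrocot n c).2) := by
  induction i with
  | zero => simp
  | succ i ih =>
    have e : 2 ^ (i + 1) * c + 1 = 2 * (2 ^ i * c) + 1 := by ring
    rw [e, ← add_assoc, sternBrocot_odd, ih, sternBrocot_refine]
    ext <;> push_cast <;> ring

/-- Refining a cell replaces one end denominator by the sum of both, so their sum grows by at least
1. This forces the mesh of `F_n` to 0. -/
lemma le_sternBrocot_den_add (n j : ℕ) :
    n + 2 ≤ (sternBrocot n j).2 + (sternBrocot n (j + 1)).2 := by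
  induction n generalizing j with
  | zero =>
    have h1 := sternBrocot_den_pos 0 j
    have h2 := sternBrocot_den_pos 0 (j + 1)
    omega
  | succ n ih =>
    rcases Nat.even_or_odd' j with ⟨k, rfl | rfl⟩
    · rw [sternBrocot_even, sternBrocot_odd]
      have := ih k
      have := sternBrocot_den_pos n k
      simp only; omega
    · rw [show 2 * k + 1 + 1 = 2 * (k + 1) by ring, sternBrocot_even, sternBrocot_odd]
      have := ih k
      have := sternBrocot_den_pos n (k + 1)
      simp only; omega

lemma sternBrocotPoint_succ_sub_le (n j : ℕ) (hj : j < 2 ^ n) :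
    sternBrocotPoint n (j + 1) - sternBrocotPoint n j ≤ 1 / ((n : ℝ) + 1) := by
  rw [sternBrocotPoint_succ_sub n j hj]
  have h0 := le_sternBrocot_den_add n j
  have h1 := sternBrocot_den_pos n j
  have h2 := sternBrocot_den_pos n (j + 1)
  apply one_div_le_one_div_of_le (by positivity)
  have : n + 1 ≤ (sternBrocot n j).2 * (sternBrocot n (j + 1)).2 := by nlinarith
  exact_mod_cast this

lemma sternBrocotPoint_ne_irrational {x : ℝ} (hx : Irrational x) (n j : ℕ) :
    sternBrocotPoint n j ≠ x := by
  intro h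
  apply hx
  exact ⟨((sternBrocot n j).1 : ℚ) / ((sternBrocot n j).2 : ℚ), by
    rw [← h, sternBrocotPoint]; push_cast; rfl⟩

lemma exists_inCell {x : ℝ} (h0 : 0 ≤ x) (h1 : x ≤ 1) (n : ℕ) : ∃ j, InCell x n j := by
  induction n with
  | zero =>
    refine ⟨0, by simp, ?_, ?_⟩
    · rwa [sternBrocotPoint_zero]
    · simpa using (sternBrocotPoint_last 0).symm ▸ h1
  | succ n ih =>
    obtain ⟨j, hj, h2, h3⟩ := ih
    have e1 := sternBrocotPoint_refine n 1 j
    have e2 := sternBrocotPoint_refine n 1 (j + 1)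
    rw [pow_one] at e1 e2
    rcases le_total x (sternBrocotPoint (n + 1) (2 * j + 1)) with h | h
    · exact ⟨2 * j, by rw [pow_succ]; omega, by rwa [e1], h⟩
    · exact ⟨2 * j + 1, by rw [pow_succ]; omega, h, by
        rwa [show 2 * j + 1 + 1 = 2 * (j + 1) by ring, e2]⟩

lemma InCell.unique {x : ℝ} (hx : Irrational x) {n i j : ℕ} (hi : InCell x n i)
    (hj : InCell x n j) : i = j := by
  have key : ∀ {i j : ℕ}, InCell x n i → InCell x n j → ¬ i < j := by
    intro i j hi hj hlt
    have h1 : sternBrocotPoint n (i + 1) ≤ sternBrocotPoint n j := by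
      rcases (Nat.succ_le_of_lt hlt).eq_or_lt with h | h
      · rw [← h]
      · exact (sternBrocotPoint_lt n h hj.1.le).le
    exact sternBrocotPoint_ne_irrational hx n j (le_antisymm hj.2.1 (hi.2.2.trans h1))
  have := key hi hj
  have := key hj hi
  omega

/-! ### Difference quotients compared with cell slopes -/

/-- Between `a < b` there is a mediant `m` whose neighbours in some `F_N` enclose `[a, b]`, while
one of its neighbours in `F_(N+1)` does not. -/
lemma exists_tight_mediant {a b : ℝ} (h0 : 0 ≤ a) (hab : a < b) (h1 : b ≤ 1) (M : ℕ)
    (hM : ∀ c ≤ 2 ^ M, ¬ (a ≤ sternBrocotPoint M c ∧ sternBrocotPoint M c ≤ b)) :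
    ∃ n j i : ℕ, M ≤ n ∧ j < 2 ^ n ∧
      sternBrocotPoint n j < a ∧ b < sternBrocotPoint n (j + 1) ∧
      a ≤ sternBrocotPoint (n + 1) (2 * j + 1) ∧ sternBrocotPoint (n + 1) (2 * j + 1) ≤ b ∧
      sternBrocotPoint (n + 1 + i) (2 ^ i * (2 * j + 1) - 1) ≤ a ∧
      b ≤ sternBrocotPoint (n + 1 + i) (2 ^ i * (2 * j + 1) + 1) ∧
      1 / 2 ^ (n + 1 + i + 1) ≤ questionMark b - questionMark a := by
  classical
  -- The first level with a point in `[a, b]` will be `n + 1`; `hM` puts it beyond `M`.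
  have hex : ∃ N c, c ≤ 2 ^ N ∧ a ≤ sternBrocotPoint N c ∧ sternBrocotPoint N c ≤ b := by
    obtain ⟨n, hn⟩ := exists_nat_one_div_lt (sub_pos.2 hab)
    obtain ⟨j, hj, h2, h3⟩ := exists_inCell h0 (hab.le.trans h1) n
    have := sternBrocotPoint_succ_sub_le n j hj
    exact ⟨n, j + 1, hj, h3, by linarith⟩
  obtain ⟨c, hc, hac, hcb⟩ := Nat.find_spec hex
  have hmin : ∀ N < Nat.find hex, ∀ c ≤ 2 ^ N,
      ¬ (a ≤ sternBrocotPoint N c ∧ sternBrocotPoint N c ≤ b) := by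
    intro N hN c hc h
    exact Nat.find_min hex hN ⟨c, hc, h⟩
  have hMN : M < Nat.find hex := by
    by_contra! hle
    obtain ⟨k, rfl⟩ := Nat.exists_eq_add_of_le hle
    refine hM (2 ^ k * c) ?_ ⟨?_, ?_⟩
    · rw [pow_add, mul_comm]; exact Nat.mul_le_mul_right _ hc
    · rwa [sternBrocotPoint_refine]
    · rwa [sternBrocotPoint_refine]
  obtain ⟨n, hn⟩ : ∃ n, Nat.find hex = n + 1 := ⟨Nat.find hex - 1, by omega⟩
  rw [hn] at hc hac hcb hmin hMN
  -- Points of even index already belong to `F_n`, so the first point to enter `[a, b]` is a new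
  -- mediant.
  rcases Nat.even_or_odd' c with ⟨j, rfl | rfl⟩
  · have e := sternBrocotPoint_refine n 1 j
    rw [pow_one] at e
    rw [e] at hac hcb
    exact absurd ⟨hac, hcb⟩ (hmin n (by omega) j (by rw [pow_succ] at hc; omega))
  have hj : j < 2 ^ n := by rw [pow_succ] at hc; omega
  have e1 := sternBrocotPoint_refine n 1 j
  have e2 := sternBrocotPoint_refine n 1 (j + 1)
  rw [pow_one] at e1 e2
  have hl := sternBrocotPoint_lt (n + 1) (show 2 * j < 2 * j + 1 by omega) hc
  have hr := sternBrocotPoint_lt (n + 1) (show 2 * j + 1 < 2 * (j + 1) by omega)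
    (by rw [pow_succ]; omega)
  rw [e1] at hl
  rw [e2] at hr
  have hla : sternBrocotPoint n j < a := by
    by_contra! h
    exact hmin n (by omega) j hj.le ⟨h, by linarith⟩
  have hrb : b < sternBrocotPoint n (j + 1) := by
    by_contra! h
    exact hmin n (by omega) (j + 1) hj ⟨by linarith, h⟩
  -- The neighbours of the mediant close in on it, so they cannot enclose `[a, b]` forever; the
  -- final `i` is the last one before the first failure.
  have hfar : ∃ i, ¬ (sternBrocotPoint (n + 1 + i) (2 ^ i * (2 * j + 1) - 1) ≤ a ∧
      b ≤ sternBrocotPoint (n + 1 + i) (2 ^ i * (2 * j + 1) + 1)) := by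
    by_contra! h
    obtain ⟨i, hi⟩ := exists_nat_one_div_lt (half_pos (sub_pos.2 hab))
    have hp : 0 < 2 ^ i * (2 * j + 1) := by positivity
    have hle : 2 ^ i * (2 * j + 1) + 1 ≤ 2 ^ (n + 1 + i) := by
      have : 0 < 2 ^ i := by positivity
      rw [pow_add, pow_succ]; nlinarith
    have g1 := sternBrocotPoint_succ_sub_le (n + 1 + i) (2 ^ i * (2 * j + 1) - 1) (by omega)
    have g2 := sternBrocotPoint_succ_sub_le (n + 1 + i) (2 ^ i * (2 * j + 1)) (by omega)
    rw [Nat.sub_add_cancel hp] at g1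
    have g3 : 1 / (((n + 1 + i : ℕ) : ℝ) + 1) ≤ 1 / ((i : ℝ) + 1) := by
      apply one_div_le_one_div_of_le (by positivity)
      push_cast
      have : (0 : ℝ) ≤ n := by positivity
      linarith
    obtain ⟨g4, g5⟩ := h i
    linarith
  have hi0 : Nat.find hfar ≠ 0 := by
    intro h
    apply Nat.find_spec hfar
    rw [h]
    simp only [pow_zero, one_mul, add_zero, Nat.add_sub_cancel]
    rw [show 2 * j + 1 + 1 = 2 * (j + 1) by ring, e1, e2]
    exact ⟨hla.le, hrb.le⟩
  obtain ⟨i, hi⟩ := Nat.exists_eq_succ_of_ne_zero hi0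
  have hspec := Nat.find_spec hfar
  obtain ⟨g1, g2⟩ := not_not.1 (Nat.find_min hfar (show i < Nat.find hfar by omega))
  rw [hi] at hspec
  refine ⟨n, j, i, by omega, hj, hla, hrb, hac, hcb, g1, g2, ?_⟩
  have hp : 0 < 2 ^ (i + 1) * (2 * j + 1) := by positivity
  have hle : 2 ^ (i + 1) * (2 * j + 1) + 1 ≤ 2 ^ (n + 1 + (i + 1)) := by
    have : 0 < 2 ^ (i + 1) := by positivity
    rw [pow_add 2 (n + 1), pow_succ 2 n]; nlinarith
  have em := questionMark_sternBrocotPoint (n + 1 + (i + 1)) (2 ^ (i + 1) * (2 * j + 1)) (by omega)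
  rw [sternBrocotPoint_refine] at em
  have ha := questionMark_monotone hac
  have hb := questionMark_monotone hcb
  rw [em] at ha hb
  -- At depth `i + 1` some neighbour of the mediant lies inside `[a, b]`, so `?` rises over `[a, b]`
  -- by at least its increment on one whole cell of that level.
  by_cases hL : sternBrocotPoint (n + 1 + (i + 1)) (2 ^ (i + 1) * (2 * j + 1) - 1) ≤ a
  · have hR := not_le.1 fun h => hspec ⟨hL, h⟩
    have := questionMark_monotone hR.le
    rw [questionMark_sternBrocotPoint _ _ hle] at this
    rw [← add_assoc] at this ha
    have e3 : ((2 ^ (i + 1) * (2 * j + 1) + 1 : ℕ) : ℝ) / 2 ^ (n + 1 + i + 1) =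
      ((2 ^ (i + 1) * (2 * j + 1) : ℕ) : ℝ) / 2 ^ (n + 1 + i + 1) + 1 / 2 ^ (n + 1 + i + 1) := by
      push_cast; ring
    linarith
  · have := questionMark_monotone (not_le.1 hL).le
    rw [questionMark_sternBrocotPoint _ _ (by omega)] at this
    rw [← add_assoc] at this hb
    have e3 : ((2 ^ (i + 1) * (2 * j + 1) - 1 : ℕ) : ℝ) / 2 ^ (n + 1 + i + 1) =
      ((2 ^ (i + 1) * (2 * j + 1) : ℕ) : ℝ) / 2 ^ (n + 1 + i + 1) - 1 / 2 ^ (n + 1 + i + 1) := by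
      rw [Nat.cast_sub hp]; push_cast; ring
    linarith

/-- The slope of `?` over `[a, b]` is bounded below by the slopes over cells of `a` and of `b`. -/
lemma exists_cellSlope_le {a b : ℝ} (h0 : 0 ≤ a) (hab : a < b) (h1 : b ≤ 1) (M : ℕ)
    (hM : ∀ c ≤ 2 ^ M, ¬ (a ≤ sternBrocotPoint M c ∧ sternBrocotPoint M c ≤ b)) :
    (∃ n j, M ≤ n ∧ InCell a n j ∧
      cellSlope n j ≤ 6 * ((questionMark b - questionMark a) / (b - a))) ∧
    (∃ n j, M ≤ n ∧ InCell b n j ∧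
      cellSlope n j ≤ 6 * ((questionMark b - questionMark a) / (b - a))) := by
  obtain ⟨n, j, i, hn, hj, hla, hrb, hac, hcb, g1, g2, hq⟩ :=
    exists_tight_mediant h0 hab h1 M hM
  have hba := sub_pos.2 hab
  -- The constant 6 is the 3 in this bound on `b - a` times the 2 lost in `hq` by passing to depth
  -- `i + 1`.
  have main : ∀ (k l : ℕ), k ≤ n + 1 + i →
      b - a ≤ 3 / 2 ^ (n + 1 + i - k) / ((sternBrocot k l).2 * (sternBrocot k (l + 1)).2 : ℝ) →
      cellSlope k l ≤ 6 * ((questionMark b - questionMark a) / (b - a)) := by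
    intro k l hk h
    have h1 : (0 : ℝ) < (sternBrocot k l).2 := by exact_mod_cast sternBrocot_den_pos k l
    have h2 : (0 : ℝ) < (sternBrocot k (l + 1)).2 := by
      exact_mod_cast sternBrocot_den_pos k (l + 1)
    rw [cellSlope, ← mul_div_assoc, div_le_div_iff₀ (by positivity) hba]
    rw [div_div, le_div_iff₀ (by positivity)] at h
    have e : (2 : ℝ) ^ (n + 1 + i) = 2 ^ (n + 1 + i - k) * 2 ^ k := by
      rw [← pow_add, Nat.sub_add_cancel hk]
    rw [pow_succ, e, div_le_iff₀ (by positivity)] at hq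
    have hp : (0 : ℝ) < 2 ^ (n + 1 + i - k) := by positivity
    have : (((sternBrocot k l).2 : ℝ) * (sternBrocot k (l + 1)).2 * (b - a)) *
        2 ^ (n + 1 + i - k) ≤ (6 * (questionMark b - questionMark a) * 2 ^ k) *
        2 ^ (n + 1 + i - k) := by
      nlinarith
    exact le_of_mul_le_mul_right this hp
  -- For `i = 0` the neighbours of the mediant are its parents, whose denominators need not be
  -- comparable; but the parent cell contains both `a` and `b`.
  rcases Nat.eq_zero_or_pos i with rfl | hi
  · have hs : cellSlope n j ≤ 6 * ((questionMark b - questionMark a) / (b - a)) := by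
      apply main n j (by omega)
      rw [show n + 1 + 0 - n = 1 by omega, pow_one, ← mul_one_div,
        ← sternBrocotPoint_succ_sub n j hj]
      linarith
    exact ⟨⟨n, j, hn, ⟨hj, hla.le, by linarith⟩, hs⟩, ⟨n, j, hn, ⟨hj, by linarith, hrb.le⟩, hs⟩⟩
  have hp : 0 < 2 ^ i * (2 * j + 1) := by positivity
  have hle : 2 ^ i * (2 * j + 1) + 1 ≤ 2 ^ (n + 1 + i) := by
    have : 0 < 2 ^ i := by positivity
    rw [pow_add, pow_succ 2 n]; nlinarith
  have em := sternBrocotPoint_refine (n + 1) i (2 * j + 1)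
  have d1 := sternBrocotPoint_succ_sub (n + 1 + i) (2 ^ i * (2 * j + 1) - 1) (by omega)
  have d2 := sternBrocotPoint_succ_sub (n + 1 + i) (2 ^ i * (2 * j + 1)) (by omega)
  have r1 := sternBrocot_run_left (n + 1) i (2 * j)
  have r2 := sternBrocot_run_right (n + 1) i (2 * j + 1)
  have r3 := sternBrocot_refine (n + 1) i (2 * j + 1)
  have m1 := main (n + 1 + i) (2 ^ i * (2 * j + 1) - 1) le_rfl
  have m2 := main (n + 1 + i) (2 ^ i * (2 * j + 1)) le_rfl
  rw [Nat.sub_add_cancel hp] at d1 m1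
  rw [Nat.sub_self, pow_zero, div_one] at m1 m2
  have c1 : InCell a (n + 1 + i) (2 ^ i * (2 * j + 1) - 1) :=
    ⟨by omega, g1, by rwa [Nat.sub_add_cancel hp, em]⟩
  have c2 : InCell b (n + 1 + i) (2 ^ i * (2 * j + 1)) := ⟨by omega, by rwa [em], g2⟩
  have e0 : sternBrocot (n + 1) (2 * j + 1) = _ := sternBrocot_odd n j
  rw [show 2 * j + 1 + 1 = 2 * (j + 1) by ring, sternBrocot_even] at r2
  rw [sternBrocot_even] at r1
  have p1 := sternBrocot_den_pos n j
  have p2 := sternBrocot_den_pos n (j + 1)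
  -- Both neighbours contain `i ≥ 1` copies of the mediant, so their denominators agree up to a
  -- factor 2, and each of the two cells at the mediant is at least a third of their union.
  have l1 : (sternBrocot (n + 1 + i) (2 ^ i * (2 * j + 1) - 1)).2 ≤
      2 * (sternBrocot (n + 1 + i) (2 ^ i * (2 * j + 1) + 1)).2 := by
    rw [r1, r2, e0]; simp only; nlinarith
  have l2 : (sternBrocot (n + 1 + i) (2 ^ i * (2 * j + 1) + 1)).2 ≤
      2 * (sternBrocot (n + 1 + i) (2 ^ i * (2 * j + 1) - 1)).2 := by
    rw [r1, r2, e0]; simp only; nlinarith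
  have q1 := sternBrocot_den_pos (n + 1 + i) (2 ^ i * (2 * j + 1) - 1)
  have q2 := sternBrocot_den_pos (n + 1 + i) (2 ^ i * (2 * j + 1))
  have q3 := sternBrocot_den_pos (n + 1 + i) (2 ^ i * (2 * j + 1) + 1)
  rw [← em] at hac hcb
  generalize sternBrocotPoint (n + 1 + i) (2 ^ i * (2 * j + 1)) = pm at *
  generalize (sternBrocot (n + 1 + i) (2 ^ i * (2 * j + 1) - 1)).2 = u at *
  generalize (sternBrocot (n + 1 + i) (2 ^ i * (2 * j + 1))).2 = m at *
  generalize (sternBrocot (n + 1 + i) (2 ^ i * (2 * j + 1) + 1)).2 = v at *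
  have q1' : (0 : ℝ) < u := by exact_mod_cast q1
  have q2' : (0 : ℝ) < m := by exact_mod_cast q2
  have q3' : (0 : ℝ) < v := by exact_mod_cast q3
  have l1' : (u : ℝ) ≤ 2 * v := by exact_mod_cast l1
  have l2' : (v : ℝ) ≤ 2 * u := by exact_mod_cast l2
  have s1 : 1 / ((m : ℝ) * v) ≤ 2 / (u * m) := by
    rw [div_le_div_iff₀ (by positivity) (by positivity)]; nlinarith
  have s2 : 1 / ((u : ℝ) * m) ≤ 2 / (m * v) := by
    rw [div_le_div_iff₀ (by positivity) (by positivity)]; nlinarith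
  have t1 : 3 / ((u : ℝ) * m) = 1 / (u * m) + 2 / (u * m) := by ring
  have t2 : 3 / ((m : ℝ) * v) = 1 / (m * v) + 2 / (m * v) := by ring
  exact ⟨⟨_, _, by omega, c1, m1 (by linarith)⟩, ⟨_, _, by omega, c2, m2 (by linarith)⟩⟩

/-- `F_M` is finite and omits the irrational `x`. The form with absolute values serves both sides of
`x` and yields the hypothesis `hM` of `exists_cellSlope_le`. -/
lemma eventually_sternBrocotPoint_not_between {x : ℝ} (hx : Irrational x) (M : ℕ) :
    ∀ᶠ y in nhds x, ∀ c ≤ 2 ^ M, |y - x| < |sternBrocotPoint M c - x| := by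
  have h : ∀ᶠ y in nhds x, ∀ c ∈ Finset.range (2 ^ M + 1),
      |y - x| < |sternBrocotPoint M c - x| := by
    rw [Filter.eventually_all_finset]
    intro c _
    have hpos : 0 < |sternBrocotPoint M c - x| :=
      abs_pos.2 (sub_ne_zero.2 (sternBrocotPoint_ne_irrational hx M c))
    filter_upwards [Metric.ball_mem_nhds x hpos] with y hy
    rwa [Metric.mem_ball, Real.dist_eq] at hy
  filter_upwards [h] with y hy c hc
  exact hy c (Finset.mem_range.2 (by omega))

/-- If the slopes of `?` over the cells of `x` tend to infinity, then `?'(x) = +∞`. -/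
theorem hasExtDerivAt_top_of_cellSlope {x : ℝ} (hx01 : x ∈ Set.Ioo (0 : ℝ) 1)
    (hx : Irrational x)
    (h : ∀ R : ℝ, ∃ M, ∀ n j, M ≤ n → InCell x n j → R ≤ cellSlope n j) :
    HasExtDerivAt questionMark ⊤ x := by
  unfold HasExtDerivAt
  rw [EReal.tendsto_nhds_top_iff_real]
  intro R
  obtain ⟨M, hM⟩ := h (6 * (R + 1))
  have h01 : ∀ᶠ y in nhds x, y ∈ Set.Ioo (0 : ℝ) 1 := isOpen_Ioo.mem_nhds hx01
  filter_upwards [self_mem_nhdsWithin, nhdsWithin_le_nhds h01,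
    nhdsWithin_le_nhds (eventually_sternBrocotPoint_not_between hx M)] with y hne hy hclose
  rw [EReal.coe_lt_coe_iff]
  rcases lt_or_gt_of_ne (show y ≠ x from hne) with hlt | hlt
  · obtain ⟨n, j, hn, hc, hs⟩ := (exists_cellSlope_le hy.1.le hlt hx01.2.le M (by
      rintro c hc ⟨h1, h2⟩
      have := hclose c hc
      rw [abs_of_neg (by linarith), abs_of_nonpos (by linarith)] at this
      linarith)).2
    have := hM n j hn hc
    rw [← neg_sub x y, ← neg_sub (questionMark x), neg_div_neg_eq]
    linarith
  · obtain ⟨n, j, hn, hc, hs⟩ := (exists_cellSlope_le hx01.1.le hlt hy.2.le M (by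
      rintro c hc ⟨h1, h2⟩
      have := hclose c hc
      rw [abs_of_pos (by linarith), abs_of_nonneg (by linarith)] at this
      linarith)).1
    have := hM n j hn hc
    linarith

/-- If `?` has an extended derivative at `x`, it is the limit of the slopes over cells of `x`. -/
theorem HasExtDerivAt.tendsto_cellSlope {x : ℝ} (hx : Irrational x) {L : EReal}
    (h : HasExtDerivAt questionMark L x) {n j : ℕ → ℕ} (hn : Filter.Tendsto n .atTop .atTop)
    (hc : ∀ k, InCell x (n k) (j k)) :
    Filter.Tendsto (fun k => (cellSlope (n k) (j k) : EReal)) .atTop (nhds L) := by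
  set l : ℕ → ℝ := fun k => sternBrocotPoint (n k) (j k) with hl
  set r : ℕ → ℝ := fun k => sternBrocotPoint (n k) (j k + 1) with hr
  have hlx : ∀ k, l k < x := fun k =>
    lt_of_le_of_ne (hc k).2.1 (sternBrocotPoint_ne_irrational hx _ _)
  have hxr : ∀ k, x < r k := fun k =>
    lt_of_le_of_ne (hc k).2.2 (sternBrocotPoint_ne_irrational hx _ _).symm
  have hw : ∀ k, r k - l k ≤ 1 / ((n k : ℝ) + 1) := fun k =>
    sternBrocotPoint_succ_sub_le _ _ (hc k).1
  have hw0 : Filter.Tendsto (fun k => 1 / ((n k : ℝ) + 1)) .atTop (nhds 0) :=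
    tendsto_one_div_add_atTop_nhds_zero_nat.comp hn
  have tl : Filter.Tendsto l .atTop (nhdsWithin x {x}ᶜ) := by
    rw [tendsto_nhdsWithin_iff]
    refine ⟨?_, Filter.Eventually.of_forall fun k => (hlx k).ne⟩
    have : Filter.Tendsto (fun k => x - 1 / ((n k : ℝ) + 1)) .atTop (nhds x) := by
      simpa using tendsto_const_nhds.sub hw0
    exact tendsto_of_tendsto_of_tendsto_of_le_of_le this tendsto_const_nhds
      (fun k => by dsimp only; linarith [hw k, hxr k]) (fun k => (hlx k).le)
  have tr : Filter.Tendsto r .atTop (nhdsWithin x {x}ᶜ) := by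
    rw [tendsto_nhdsWithin_iff]
    refine ⟨?_, Filter.Eventually.of_forall fun k => (hxr k).ne'⟩
    have : Filter.Tendsto (fun k => x + 1 / ((n k : ℝ) + 1)) .atTop (nhds x) := by
      simpa using tendsto_const_nhds.add hw0
    exact tendsto_of_tendsto_of_tendsto_of_le_of_le tendsto_const_nhds this
      (fun k => (hxr k).le) (fun k => by dsimp only; linarith [hw k, hlx k])
  have sl := h.comp tl
  have sr := h.comp tr
  -- The slope over a cell is a weighted mean of the difference quotients from `x` to its two ends,
  -- hence lies between their minimum and maximum.
  have lo := sl.min sr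
  have up := sl.max sr
  rw [min_self] at lo
  rw [max_self] at up
  refine tendsto_of_tendsto_of_tendsto_of_le_of_le lo up (fun k => ?_) (fun k => ?_)
  all_goals
    have e := cellSlope_eq (n k) (j k) (hc k).1
    have h1 := sub_pos.2 (hlx k)
    have h2 := sub_pos.2 (hxr k)
    have h3 : 0 < r k - l k := by linarith
    change cellSlope (n k) (j k) = (questionMark (r k) - questionMark (l k)) / (r k - l k) at e
    simp only [Function.comp_apply]
    rw [e]
    have el : questionMark x - questionMark (l k) =
        (questionMark (l k) - questionMark x) / (l k - x) * (x - l k) := by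
      have : l k - x ≠ 0 := by linarith
      field_simp
      ring
    have er : questionMark (r k) - questionMark x =
        (questionMark (r k) - questionMark x) / (r k - x) * (r k - x) := by
      field_simp
  · generalize (questionMark (l k) - questionMark x) / (l k - x) = A at *
    generalize (questionMark (r k) - questionMark x) / (r k - x) = B at *
    rw [← EReal.coe_strictMono.monotone.map_min, EReal.coe_le_coe_iff, le_div_iff₀ h3]
    nlinarith [min_le_left A B, min_le_right A B]
  · generalize (questionMark (l k) - questionMark x) / (l k - x) = A at *
    generalize (questionMark (r k) - questionMark x) / (r k - x) = B at *
    rw [← EReal.coe_strictMono.monotone.map_max, EReal.coe_le_coe_iff, div_le_iff₀ h3]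
    nlinarith [le_max_left A B, le_max_right A B]

/-! ### Infinite continued fractions -/

/-- `a` are the partial quotients and `θ` the complete remainders of the infinite continued
fraction `θ 0 = [0; a 0, a 1, …]`. -/
structure IsCFExpansion (a : ℕ → ℕ) (θ : ℕ → ℝ) : Prop where
  mem : ∀ t, θ t ∈ Set.Ioo (0 : ℝ) 1
  pos : ∀ t, 1 ≤ a t
  step : ∀ t, θ t * (a t + θ (t + 1)) = 1

variable {a : ℕ → ℕ} {θ : ℕ → ℝ}

lemma IsCFExpansion.inv_eq (h : IsCFExpansion a θ) (t : ℕ) : (θ t)⁻¹ = a t + θ (t + 1) :=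
  inv_eq_of_mul_eq_one_right (h.step t)

/-- Only the fractional part of `v` is prescribed because the recursion passes to `(Int.fract v)⁻¹ =
a s + θ (s + 1)`, which is outside `[0, 1)`. -/
lemma IsCFExpansion.get?_of (h : IsCFExpansion a θ) {v : ℝ} {s : ℕ} (hv : Int.fract v = θ s)
    (t : ℕ) : (GenContFract.of v).s.get? t = some ⟨1, (a (s + t) : ℝ)⟩ := by
  induction t generalizing s v with
  | zero =>
    have h0 : Int.fract v ≠ 0 := by rw [hv]; exact (h.mem s).1.ne'
    have := GenContFract.of_s_head h0
    rw [hv, h.inv_eq] at this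
    have e : ⌊(a s : ℝ) + θ (s + 1)⌋ = (a s : ℤ) := by
      rw [Int.floor_eq_iff]
      have := h.mem (s + 1)
      push_cast
      exact ⟨by linarith [this.1], by linarith [this.2]⟩
    rw [e] at this
    exact_mod_cast this
  | succ t ih =>
    rw [GenContFract.of_s_succ, hv, h.inv_eq, ih (s := s + 1), add_right_comm, add_assoc]
    rw [Int.fract_natCast_add, Int.fract_eq_self]
    exact ⟨(h.mem _).1.le, (h.mem _).2⟩

lemma IsCFExpansion.fract_zero (h : IsCFExpansion a θ) : Int.fract (θ 0) = θ 0 :=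
  Int.fract_eq_self.2 ⟨(h.mem 0).1.le, (h.mem 0).2⟩

lemma IsCFExpansion.partialQuotient (h : IsCFExpansion a θ) (t : ℕ) :
    partialQuotient (θ 0) t = a t := by
  rw [MinkowskiQM.partialQuotient,
    GenContFract.partDen_eq_s_b (h.get?_of h.fract_zero t), zero_add]
  rfl

lemma IsCFExpansion.irrational (h : IsCFExpansion a θ) : Irrational (θ 0) := by
  rintro ⟨q, hq⟩
  obtain ⟨n, hn⟩ := (GenContFract.terminates_iff_rat (θ 0)).2 ⟨q, hq.symm⟩
  have hn' := GenContFract.terminatedAt_iff_s_none.1 hn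
  rw [h.get?_of h.fract_zero] at hn'
  exact absurd hn' (by simp)

lemma exists_isCFExpansion_of_irrational {x : ℝ} (hx : Irrational x)
    (h01 : x ∈ Set.Ioo (0 : ℝ) 1) : ∃ a θ, IsCFExpansion a θ ∧ θ 0 = x := by
  let θ : ℕ → ℝ := fun t => Nat.rec x (fun _ y => Int.fract y⁻¹) t
  have hs : ∀ t, θ (t + 1) = Int.fract (θ t)⁻¹ := fun t => rfl
  have hirr : ∀ t, Irrational (θ t) := by
    intro t
    induction t with
    | zero => exact hx
    | succ t ih => rw [hs, Int.fract]; exact (irrational_inv_iff.2 ih).sub_intCast _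
  have hmem : ∀ t, θ t ∈ Set.Ioo (0 : ℝ) 1 := by
    intro t
    cases t with
    | zero => exact h01
    | succ t =>
      refine ⟨lt_of_le_of_ne ?_ (hirr (t + 1)).ne_zero.symm, ?_⟩
      · rw [hs]; exact Int.fract_nonneg _
      · rw [hs]; exact Int.fract_lt_one _
  refine ⟨fun t => ⌊(θ t)⁻¹⌋₊, θ, ⟨hmem, fun t => ?_, fun t => ?_⟩, rfl⟩
  · rw [Nat.one_le_floor_iff]
    exact (one_lt_inv_iff₀.2 (hmem t)).le
  · have hp := (hmem t).1
    rw [hs, natCast_floor_eq_intCast_floor (inv_nonneg.2 hp.le), Int.floor_add_fract,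
      mul_inv_cancel₀ hp.ne']

/-- Compactness: the sequences in `[0, 1]` satisfying the first `N` relations form decreasing
nonempty closed subsets of a compact product, and a common point satisfies all relations. -/
lemma exists_isCFExpansion (ha : ∀ t, 1 ≤ a t) : ∃ θ, IsCFExpansion a θ := by
  let E : ℕ → Set (ℕ → ℝ) := fun N =>
    {x | x ∈ Set.univ.pi (fun _ => Set.Icc (0 : ℝ) 1) ∧ ∀ i < N, x i * (a i + x (i + 1)) = 1}
  have hcl : ∀ N, IsClosed (E N) := by
    intro N
    have : E N = Set.univ.pi (fun _ => Set.Icc (0 : ℝ) 1) ∩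
        ⋂ i < N, {x | x i * (a i + x (i + 1)) = 1} := by
      ext x; simp [E]
    rw [this]
    exact (isClosed_set_pi fun _ _ => isClosed_Icc).inter <|
      isClosed_iInter fun i => isClosed_iInter fun _ => isClosed_eq (by fun_prop) (by fun_prop)
  have hne : ∀ N, (E N).Nonempty := by
    intro N
    -- Generalised over the sequence, since the induction prepends a term to a solution for the
    -- shifted one.
    suffices H : ∀ (b : ℕ → ℕ), (∀ t, 1 ≤ b t) → ∃ x : ℕ → ℝ,
        (∀ i, x i ∈ Set.Icc (0 : ℝ) 1) ∧ ∀ i < N, x i * (b i + x (i + 1)) = 1 by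
      obtain ⟨x, h1, h2⟩ := H a ha
      exact ⟨x, fun i _ => h1 i, h2⟩
    induction N with
    | zero => exact fun b hb => ⟨0, fun i => by simp, by simp⟩
    | succ N ih =>
      intro b hb
      obtain ⟨x, h1, h2⟩ := ih (fun t => b (t + 1)) fun t => hb _
      have hb0 : (1 : ℝ) ≤ b 0 := by exact_mod_cast hb 0
      have hpos : 1 ≤ b 0 + x 0 := by linarith [(h1 0).1]
      refine ⟨fun n => Nat.casesOn n (b 0 + x 0)⁻¹ x, fun i => ?_, fun i hi => ?_⟩
      · cases i with
        | zero => exact ⟨inv_nonneg.2 (by linarith), inv_le_one_of_one_le₀ hpos⟩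
        | succ i => exact h1 i
      · cases i with
        | zero => exact inv_mul_cancel₀ (by linarith)
        | succ i => exact h2 i (by omega)
  obtain ⟨θ, hθ⟩ := IsCompact.nonempty_iInter_of_sequence_nonempty_isCompact_isClosed E
    (fun N x hx => ⟨hx.1, fun i hi => hx.2 i (by omega)⟩) hne
    ((isCompact_univ_pi fun _ => isCompact_Icc).of_isClosed_subset (hcl 0) fun x hx => hx.1) hcl
  rw [Set.mem_iInter] at hθ
  have hstep : ∀ t, θ t * (a t + θ (t + 1)) = 1 := fun t => (hθ (t + 1)).2 t (by omega)
  have hIcc : ∀ t, θ t ∈ Set.Icc (0 : ℝ) 1 := fun t => (hθ 0).1 t trivial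
  have hpos : ∀ t, 0 < θ t := fun t => lt_of_le_of_ne (hIcc t).1 fun h => by
    have := hstep t; rw [← h, zero_mul] at this; exact zero_ne_one this
  refine ⟨θ, fun t => ⟨hpos t, ?_⟩, ha, hstep⟩
  have h1 : (1 : ℝ) ≤ a t := by exact_mod_cast ha t
  nlinarith [hstep t, hpos t, hpos (t + 1), mul_pos (hpos t) (hpos (t + 1))]

/-! ### Convergents and the cells containing `x` -/

/-- The convergents `(p, q)` of `[0; a 0, a 1, …]`, preceded by `(1, 0)` and `(0, 1)`. -/
def convergent (a : ℕ → ℕ) : ℕ → ℕ × ℕ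
  | 0 => (1, 0)
  | 1 => (0, 1)
  | t + 2 => (a t * (convergent a (t + 1)).1 + (convergent a t).1,
      a t * (convergent a (t + 1)).2 + (convergent a t).2)

/-- `A` and `B` are, in some order, the end points of an interval of `F_n`. -/
def AreNeighbours (n : ℕ) (A B : ℕ × ℕ) : Prop :=
  ∃ j < 2 ^ n, (sternBrocot n j = A ∧ sternBrocot n (j + 1) = B) ∨
    (sternBrocot n j = B ∧ sternBrocot n (j + 1) = A)

lemma AreNeighbours.symm {n : ℕ} {A B : ℕ × ℕ} (h : AreNeighbours n A B) :
    AreNeighbours n B A := by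
  obtain ⟨j, hj, h⟩ := h
  exact ⟨j, hj, h.symm⟩

lemma AreNeighbours.left {n : ℕ} {A B : ℕ × ℕ} (h : AreNeighbours n A B) :
    AreNeighbours (n + 1) A (A + B) := by
  obtain ⟨j, hj, ⟨rfl, rfl⟩ | ⟨rfl, rfl⟩⟩ := h
  · refine ⟨2 * j, by rw [pow_succ]; omega, .inl ⟨sternBrocot_even n j, sternBrocot_odd n j⟩⟩
  · refine ⟨2 * j + 1, by rw [pow_succ]; omega, .inr ⟨?_, sternBrocot_even n (j + 1)⟩⟩
    rw [sternBrocot_odd, add_comm (sternBrocot n (j + 1))]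
    rfl

lemma AreNeighbours.right {n : ℕ} {A B : ℕ × ℕ} (h : AreNeighbours n A B) :
    AreNeighbours (n + 1) B (A + B) := by
  rw [add_comm A]; exact h.symm.left

/-- During the run of `a t` the convergent stays an end point while the other end absorbs one more
copy of it per level. At `j = a t - 1` the other end is the next convergent, and the next level
starts its run. The side alternates, hence the unordered `AreNeighbours`. -/
lemma areNeighbours_convergent (ha : ∀ t, 1 ≤ a t) (t j : ℕ) :
    AreNeighbours (∑ i ∈ Finset.range t, a i + j) (convergent a (t + 1))
      ((j + 1) • convergent a (t + 1) + convergent a t) := by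
  have run : ∀ t, AreNeighbours (∑ i ∈ Finset.range t, a i) (convergent a (t + 1))
      (convergent a (t + 1) + convergent a t) → ∀ j,
      AreNeighbours (∑ i ∈ Finset.range t, a i + j) (convergent a (t + 1))
      ((j + 1) • convergent a (t + 1) + convergent a t) := by
    intro t h j
    induction j with
    | zero => simpa using h
    | succ j ih =>
      have := ih.left
      rwa [← add_assoc, add_comm (convergent a (t + 1)) ((j + 1) • _), ← succ_nsmul] at this
  suffices H : ∀ t, AreNeighbours (∑ i ∈ Finset.range t, a i) (convergent a (t + 1))
      (convergent a (t + 1) + convergent a t) from run t (H t) j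
  intro t
  induction t with
  | zero => exact ⟨0, by simp, .inl ⟨by simp [sternBrocot, convergent],
      by simp [sternBrocot, convergent]⟩⟩
  | succ t ih =>
    have := (run t ih (a t - 1)).right
    rw [Nat.sub_add_cancel (ha t), add_assoc, Nat.sub_add_cancel (ha t),
      ← Finset.sum_range_succ] at this
    have e : convergent a (t + 1 + 1) = a t • convergent a (t + 1) + convergent a t := by
      ext <;> simp [convergent]
    rwa [e, add_comm _ (convergent a (t + 1))]

/-- The hypothesis `hx` presents `x` as the mediant of `A` and `B` with nonnegative weights `u` and
`v`, which lies between them. -/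
lemma AreNeighbours.exists_inCell {n : ℕ} {A B : ℕ × ℕ} (h : AreNeighbours n A B) {x u v : ℝ}
    (hu : 0 ≤ u) (hv : 0 ≤ v) (huv : 0 < u * A.2 + v * B.2)
    (hx : x * (u * A.2 + v * B.2) = u * A.1 + v * B.1) :
    ∃ j, InCell x n j ∧ cellSlope n j = (A.2 * B.2 : ℝ) / 2 ^ n := by
  have key : ∀ (j : ℕ) (u v : ℝ), j < 2 ^ n → 0 ≤ u → 0 ≤ v →
      0 < u * (sternBrocot n j).2 + v * (sternBrocot n (j + 1)).2 →
      x * (u * (sternBrocot n j).2 + v * (sternBrocot n (j + 1)).2) =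
        u * (sternBrocot n j).1 + v * (sternBrocot n (j + 1)).1 → InCell x n j := by
    intro j u v hj hu hv huv hx
    have hd : ((sternBrocot n (j + 1)).1 : ℝ) * (sternBrocot n j).2 =
        (sternBrocot n j).1 * (sternBrocot n (j + 1)).2 + 1 := by
      exact_mod_cast sternBrocot_det n j hj
    have h1 : (0 : ℝ) < (sternBrocot n j).2 := by exact_mod_cast sternBrocot_den_pos n j
    have h2 : (0 : ℝ) < (sternBrocot n (j + 1)).2 := by
      exact_mod_cast sternBrocot_den_pos n (j + 1)
    have hx' := eq_div_of_mul_eq huv.ne' hx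
    refine ⟨hj, ?_, ?_⟩
    · rw [sternBrocotPoint, hx', div_le_div_iff₀ h1 huv]
      nlinarith
    · rw [sternBrocotPoint, hx', div_le_div_iff₀ huv h2]
      nlinarith
  obtain ⟨j, hj, ⟨rfl, rfl⟩ | ⟨rfl, rfl⟩⟩ := h
  · exact ⟨j, key j u v hj hu hv huv hx, rfl⟩
  · exact ⟨j, key j v u hj hv hu (by linarith) (by linarith), by rw [cellSlope, mul_comm]⟩

lemma convergent_den_pos (ha : ∀ t, 1 ≤ a t) (t : ℕ) : 1 ≤ (convergent a (t + 1)).2 := by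
  induction t with
  | zero => simp [convergent]
  | succ t ih =>
    have := ha t
    simp only [convergent]
    nlinarith

lemma IsCFExpansion.mul_convergent (h : IsCFExpansion a θ) (t : ℕ) :
    θ 0 * ((convergent a (t + 1)).2 + θ t * (convergent a t).2) =
      (convergent a (t + 1)).1 + θ t * (convergent a t).1 := by
  induction t with
  | zero => simp [convergent]
  | succ t ih =>
    have hs := h.step t
    have hp := (h.mem t).1
    have e1 : ((convergent a (t + 1 + 1)).2 : ℝ) =
      a t * (convergent a (t + 1)).2 + (convergent a t).2 := by simp [convergent]
    have e2 : ((convergent a (t + 1 + 1)).1 : ℝ) =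
      a t * (convergent a (t + 1)).1 + (convergent a t).1 := by simp [convergent]
    rw [e1, e2]
    apply mul_left_cancel₀ hp.ne'
    linear_combination ih + (θ 0 * (convergent a (t + 1)).2 - (convergent a (t + 1)).1) * hs

/-- The cell of `θ 0` in `F_n` for `n = a 0 + ⋯ + a (t - 1) + j`, `j < a t`. -/
lemma IsCFExpansion.exists_inCell (h : IsCFExpansion a θ) (t j : ℕ) (hj : j < a t) :
    ∃ k, InCell (θ 0) (∑ i ∈ Finset.range t, a i + j) k ∧
      cellSlope (∑ i ∈ Finset.range t, a i + j) k =
        ((convergent a (t + 1)).2 * ((j + 1) * (convergent a (t + 1)).2 + (convergent a t).2) : ℝ) /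
          2 ^ (∑ i ∈ Finset.range t, a i + j) := by
  have hj' : (j : ℝ) + 1 ≤ a t := by exact_mod_cast hj
  have h1 : (1 : ℝ) ≤ (convergent a (t + 1)).2 := by exact_mod_cast convergent_den_pos h.pos t
  have h2 := (h.mem t).1
  have h3 := (h.mem (t + 1)).1
  have hs := h.step t
  have hm := h.mul_convergent t
  -- As `1 / θ t = a t + θ (t + 1)`, `x` is the mediant of two successive convergents with weights
  -- `a t + θ (t + 1)` and 1; moving `j + 1` copies into the second point leaves these weights.
  obtain ⟨k, hk, e⟩ := (areNeighbours_convergent h.pos t j).exists_inCell (x := θ 0)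
    (u := a t - (j + 1) + θ (t + 1)) (v := 1) (by linarith) zero_le_one
    (by
      have : (0 : ℝ) ≤ (convergent a t).2 := by positivity
      simp only [Prod.snd_add, Prod.smul_snd, smul_eq_mul]
      push_cast
      have : 0 < ((a t : ℝ) - (j + 1) + θ (t + 1)) * (convergent a (t + 1)).2 := by
        apply mul_pos <;> linarith
      positivity)
    (by
      simp only [Prod.snd_add, Prod.fst_add, Prod.smul_snd, Prod.smul_fst, smul_eq_mul]
      push_cast
      apply mul_left_cancel₀ h2.ne'
      linear_combination hm + (θ 0 * (convergent a (t + 1)).2 - (convergent a (t + 1)).1) * hs)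
  refine ⟨k, hk, e.trans ?_⟩
  simp only [Prod.snd_add, Prod.smul_snd, smul_eq_mul]
  push_cast
  rfl

/-! ### Growth of the denominators and the golden ratio -/

-- The origin of κ₁: the least growth of a product of two consecutive denominators, of order φ^(2t),
-- written as a power of 2.
open Real in
lemma two_rpow_kappaOne_mul (t : ℕ) : (2 : ℝ) ^ (kappaOne * t) = goldenRatio ^ (2 * t) := by
  have h2 : Real.log 2 ≠ 0 := (Real.log_pos one_lt_two).ne'
  rw [Real.rpow_def_of_pos two_pos, ← Real.exp_log (pow_pos goldenRatio_pos (2 * t)), Real.log_pow,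
    kappaOne]
  congr 1
  push_cast
  field_simp

lemma two_rpow_log_div {t : ℝ} (ht : 0 < t) : (2 : ℝ) ^ (Real.log t / Real.log 2) = t := by
  rw [← Real.logb, Real.rpow_logb two_pos (by norm_num) ht]

open Real in
lemma two_lt_goldenRatio_sq : 2 < goldenRatio ^ 2 := by
  rw [goldenRatio_sq]; linarith [one_lt_goldenRatio]

open Real in
lemma one_lt_kappaOne : 1 < kappaOne := by
  have h : (2 : ℝ) ^ (1 : ℝ) < 2 ^ (kappaOne * (1 : ℕ)) := by
    rw [two_rpow_kappaOne_mul, Real.rpow_one]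
    simpa using two_lt_goldenRatio_sq
  simpa using (Real.rpow_lt_rpow_left_iff one_lt_two).1 h

/-- `(a 0 - 1) + ⋯ + (a (t - 1) - 1)`. -/
def excess (a : ℕ → ℕ) (t : ℕ) : ℕ := ∑ i ∈ Finset.range t, (a i - 1)

lemma sum_eq_add_excess (ha : ∀ t, 1 ≤ a t) (t : ℕ) :
    ∑ i ∈ Finset.range t, a i = t + excess a t := by
  rw [excess]
  induction t with
  | zero => simp
  | succ t ih =>
    have := ha t
    rw [Finset.sum_range_succ, Finset.sum_range_succ, ih]; omega

lemma excess_mono (a : ℕ → ℕ) : Monotone (excess a) :=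
  monotone_nat_of_le_succ fun t => by simp [excess, Finset.sum_range_succ]

lemma convergent_den_succ (a : ℕ → ℕ) (t : ℕ) : ((convergent a (t + 2)).2 : ℝ) =
    a t * (convergent a (t + 1)).2 + (convergent a t).2 := by
  simp [convergent]

lemma convergent_den_le_succ (ha : ∀ t, 1 ≤ a t) (t : ℕ) :
    (convergent a t).2 ≤ (convergent a (t + 1)).2 := by
  cases t with
  | zero => simp [convergent]
  | succ t =>
    have := ha t
    simp only [convergent]
    nlinarith

-- The form φ q_t + q_(t-1) is multiplied by exactly φ when the next quotient is 1. A larger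
-- quotient adds a surplus `a t - 1` times φ q_t, itself of order at least φ^t. These surpluses
-- accumulate to the factor `1 + excess a t`.
open Real in
lemma goldenRatio_pow_le_den (ha : ∀ t, 1 ≤ a t) (t : ℕ) :
    goldenRatio ^ t * (1 + excess a t) ≤ goldenRatio ^ 3 * (convergent a (t + 1)).2 := by
  have hφ := goldenRatio_pos
  have hsq := goldenRatio_sq
  have hrec : ∀ t, goldenRatio * ((convergent a (t + 2)).2 : ℝ) + (convergent a (t + 1)).2 =
      goldenRatio * (goldenRatio * (convergent a (t + 1)).2 + (convergent a t).2) +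
        goldenRatio * (a t - 1) * (convergent a (t + 1)).2 := by
    intro t
    rw [convergent_den_succ]
    linear_combination -((convergent a (t + 1)).2 : ℝ) * hsq
  have hle : ∀ t, goldenRatio * ((convergent a (t + 1)).2 : ℝ) + (convergent a t).2 ≤
      goldenRatio ^ 2 * (convergent a (t + 1)).2 := by
    intro t
    have : ((convergent a t).2 : ℝ) ≤ (convergent a (t + 1)).2 := by
      exact_mod_cast convergent_den_le_succ ha t
    rw [hsq]; linarith
  have ha' : ∀ t, (0 : ℝ) ≤ a t - 1 := fun t => by
    have : (1 : ℝ) ≤ a t := by exact_mod_cast ha t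
    linarith
  have hbase : ∀ t, goldenRatio ^ (t + 1) ≤
      goldenRatio * ((convergent a (t + 1)).2 : ℝ) + (convergent a t).2 := by
    intro t
    induction t with
    | zero => simp [convergent]
    | succ t ih =>
      rw [hrec, pow_succ']
      have := mul_nonneg (mul_nonneg hφ.le (ha' t)) (Nat.cast_nonneg (convergent a (t + 1)).2)
      have := mul_le_mul_of_nonneg_left ih hφ.le
      linarith
  suffices H : goldenRatio ^ t * (1 + excess a t) ≤
      goldenRatio * (goldenRatio * ((convergent a (t + 1)).2 : ℝ) + (convergent a t).2) by
    have := mul_le_mul_of_nonneg_left (hle t) hφ.le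
    calc _ ≤ _ := H
      _ ≤ _ := this
      _ = _ := by ring
  induction t with
  | zero =>
    have : 1 < goldenRatio ^ 2 := by linarith [two_lt_goldenRatio_sq]
    simp [convergent, excess]; nlinarith
  | succ t ih =>
    have e : ((excess a (t + 1) : ℕ) : ℝ) = excess a t + (a t - 1) := by
      rw [excess, Finset.sum_range_succ, Nat.cast_add, Nat.cast_sub (ha t)]; simp [excess]
    rw [hrec, e]
    have h1 := (hbase t).trans (hle t)
    have h2 := mul_le_mul_of_nonneg_left h1 (ha' t)
    have h3 := mul_le_mul_of_nonneg_left ih hφ.le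
    have e2 : goldenRatio ^ (t + 1) = goldenRatio * goldenRatio ^ t := pow_succ' _ _
    calc goldenRatio ^ (t + 1) * (1 + (excess a t + (a t - 1)))
        = goldenRatio * (goldenRatio ^ t * (1 + excess a t)) +
            (a t - 1) * goldenRatio ^ (t + 1) := by rw [e2]; ring
      _ ≤ _ := add_le_add h3 h2
      _ = _ := by ring

-- The same form φ q_t + q_(t-1) grows by a factor of at most φ times the next quotient.
open Real in
lemma den_le_goldenRatio_pow (ha : ∀ t, 1 ≤ a t) (t : ℕ) :
    ((convergent a (t + 1)).2 : ℝ) ≤ goldenRatio ^ t * ((∏ i ∈ Finset.range t, a i : ℕ) : ℝ) := by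
  have hφ := goldenRatio_pos
  have hsq := goldenRatio_sq
  have H : goldenRatio * ((convergent a (t + 1)).2 : ℝ) + (convergent a t).2 ≤
      goldenRatio ^ (t + 1) * ((∏ i ∈ Finset.range t, a i : ℕ) : ℝ) := by
    induction t with
    | zero => simp [convergent]
    | succ t ih =>
      have h1 : (1 : ℝ) ≤ a t := by exact_mod_cast ha t
      have h0 : (0 : ℝ) ≤ (convergent a t).2 := Nat.cast_nonneg _
      have h0' : (0 : ℝ) ≤ (convergent a (t + 1)).2 := Nat.cast_nonneg _
      rw [convergent_den_succ, Finset.prod_range_succ, Nat.cast_mul]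
      calc goldenRatio * ((a t : ℝ) * (convergent a (t + 1)).2 + (convergent a t).2) +
            (convergent a (t + 1)).2
          ≤ goldenRatio * (a t * (convergent a (t + 1)).2 + a t * (convergent a t).2) +
            a t * (convergent a (t + 1)).2 := by
              gcongr
              · exact le_mul_of_one_le_left h0 h1
              · exact le_mul_of_one_le_left h0' h1
        _ = (goldenRatio * a t) * (goldenRatio * ((convergent a (t + 1)).2 : ℝ) +
            (convergent a t).2) := by
              linear_combination -(a t : ℝ) * (convergent a (t + 1)).2 * hsq
        _ ≤ (goldenRatio * a t) *
            (goldenRatio ^ (t + 1) * ((∏ i ∈ Finset.range t, a i : ℕ) : ℝ)) :=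
              mul_le_mul_of_nonneg_left ih (by positivity)
        _ = _ := by ring
  have h0 : (0 : ℝ) ≤ (convergent a t).2 := Nat.cast_nonneg _
  rw [pow_succ'] at H
  exact le_of_mul_le_mul_left (by linarith) hφ

/-! ### Part (i): slopes tending to infinity -/

/-- Within the run of cells sharing a convergent, the last slope is, up to a factor, smallest. -/
lemma den_run_le {u v : ℝ} (hv : 0 ≤ v) (hu : 0 ≤ u) {j m : ℕ} (h : j + 1 ≤ m) :
    (m * u + v) * 2 ^ (j + 1) ≤ ((j + 1) * u + v) * 2 ^ m := by
  induction m, h using Nat.le_induction with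
  | base => push_cast; rfl
  | succ m hm ih =>
    have h1 : (1 : ℝ) ≤ m := by exact_mod_cast (by omega : 1 ≤ m)
    have : ((m + 1 : ℕ) * u + v) ≤ 2 * (m * u + v) := by push_cast; nlinarith
    calc _ ≤ 2 * (m * u + v) * 2 ^ (j + 1) := by gcongr
      _ = 2 * ((m * u + v) * 2 ^ (j + 1)) := by ring
      _ ≤ 2 * (((j + 1) * u + v) * 2 ^ m) := by gcongr
      _ = _ := by ring

lemma exists_run_index (ha : ∀ t, 1 ≤ a t) (T n : ℕ) (hn : ∑ i ∈ Finset.range T, a i ≤ n) :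
    ∃ t j, T ≤ t ∧ j < a t ∧ n = ∑ i ∈ Finset.range t, a i + j := by
  induction n, hn using Nat.le_induction with
  | base => exact ⟨T, 0, le_rfl, ha T, rfl⟩
  | succ n hn ih =>
    obtain ⟨t, j, h1, h2, rfl⟩ := ih
    by_cases hj : j + 1 < a t
    · exact ⟨t, j + 1, h1, hj, by ring⟩
    · refine ⟨t + 1, 0, by omega, ha _, ?_⟩
      rw [Finset.sum_range_succ]; omega

/-- By `den_run_le` the slopes need only be bounded below at the ends of runs, where the slope is
twice the quotient of the two sides' main terms. -/
lemma IsCFExpansion.hasExtDerivAt_top (h : IsCFExpansion a θ)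
    (hR : ∀ R : ℝ, ∃ T, ∀ t ≥ T, R * 2 ^ (∑ i ∈ Finset.range (t + 1), a i) ≤
      (convergent a (t + 1)).2 * (convergent a (t + 2)).2) :
    HasExtDerivAt questionMark ⊤ (θ 0) := by
  refine hasExtDerivAt_top_of_cellSlope (h.mem 0) h.irrational fun R => ?_
  obtain ⟨T, hT⟩ := hR (R / 2)
  refine ⟨∑ i ∈ Finset.range T, a i, fun n k hn hk => ?_⟩
  obtain ⟨t, j, htT, hj, rfl⟩ := exists_run_index h.pos T n hn
  obtain ⟨k', hk', e⟩ := h.exists_inCell t j hj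
  rw [InCell.unique h.irrational hk hk', e, le_div_iff₀ (by positivity)]
  have h1 := hT t htT
  have h2 := den_run_le (u := (convergent a (t + 1)).2) (v := (convergent a t).2)
    (Nat.cast_nonneg _) (Nat.cast_nonneg _) (show j + 1 ≤ a t from hj)
  rw [← convergent_den_succ] at h2
  rw [Finset.sum_range_succ, pow_add] at h1
  have hq : (0 : ℝ) ≤ (convergent a (t + 1)).2 := Nat.cast_nonneg _
  have hp : (0 : ℝ) < 2 ^ a t := by positivity
  refine le_of_mul_le_mul_right ?_ hp
  calc R * 2 ^ (∑ i ∈ Finset.range t, a i + j) * 2 ^ a t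
      = (R / 2 * (2 ^ (∑ i ∈ Finset.range t, a i) * 2 ^ a t)) * 2 ^ (j + 1) := by ring
    _ ≤ ((convergent a (t + 1)).2 * (convergent a (t + 2)).2) * 2 ^ (j + 1) := by gcongr
    _ = (convergent a (t + 1)).2 * ((convergent a (t + 2)).2 * 2 ^ (j + 1)) := by ring
    _ ≤ (convergent a (t + 1)).2 *
          (((j + 1) * (convergent a (t + 1)).2 + (convergent a t).2) * 2 ^ a t) :=
        mul_le_mul_of_nonneg_left h2 hq
    _ = _ := by ring

/-- 2^e / (e + 1) is nondecreasing, so an excess may be replaced by the largest one allowed. -/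
lemma succ_mul_two_pow_le {e f : ℕ} (h : e ≤ f) :
    ((f : ℝ) + 1) * 2 ^ e ≤ ((e : ℝ) + 1) * 2 ^ f := by
  induction f, h using Nat.le_induction with
  | base => rfl
  | succ f hf ih =>
    have h0 : (0 : ℝ) ≤ f := Nat.cast_nonneg _
    calc (((f + 1 : ℕ) : ℝ) + 1) * 2 ^ e ≤ (2 * (f + 1)) * 2 ^ e := by
          gcongr; push_cast; linarith
      _ = 2 * (((f : ℝ) + 1) * 2 ^ e) := by ring
      _ ≤ 2 * (((e : ℝ) + 1) * 2 ^ f) := by gcongr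
      _ = _ := by ring

open Real in
lemma goldenRatio_pow_le_den_mul_den (ha : ∀ t, 1 ≤ a t) (t : ℕ) :
    goldenRatio ^ (2 * (t + 1)) * ((1 + excess a t) * (1 + excess a (t + 1))) ≤
      goldenRatio ^ 7 * ((convergent a (t + 1)).2 * (convergent a (t + 2)).2) := by
  have hφ := goldenRatio_pos
  calc goldenRatio ^ (2 * (t + 1)) * ((1 + excess a t) * (1 + excess a (t + 1)))
      = goldenRatio * ((goldenRatio ^ t * (1 + excess a t)) *
          (goldenRatio ^ (t + 1) * (1 + excess a (t + 1)))) := by ring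
    _ ≤ goldenRatio * ((goldenRatio ^ 3 * (convergent a (t + 1)).2) *
          (goldenRatio ^ 3 * (convergent a (t + 2)).2)) :=
        mul_le_mul_of_nonneg_left (mul_le_mul (goldenRatio_pow_le_den ha t)
          (goldenRatio_pow_le_den ha (t + 1)) (by positivity) (by positivity)) hφ.le
    _ = _ := by ring

open Real in
lemma eventually_mul_two_pow_le (R : ℝ) (m : ℕ) :
    ∀ᶠ t : ℕ in .atTop, R * 2 ^ (m + t) ≤ goldenRatio ^ (2 * t) := by
  have h1 : 1 < goldenRatio ^ 2 / 2 := by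
    rw [lt_div_iff₀ two_pos]; linarith [two_lt_goldenRatio_sq]
  filter_upwards [(tendsto_pow_atTop_atTop_of_one_lt h1).eventually_ge_atTop (R * 2 ^ m)] with t ht
  rw [div_pow, le_div_iff₀ (by positivity), ← pow_mul] at ht
  calc _ = _ := by ring
    _ ≤ _ := ht

open Real in
/-- The continuants dominate `2 ^ S(t)` if `S(t) ≤ κ₁ t + log t / log 2 + C`. -/
lemma exists_two_pow_le_den_mul_den (ha : ∀ t, 1 ≤ a t) {C : ℝ} (hC0 : 0 ≤ C)
    (hC : ∀ t : ℕ, 1 ≤ t → ((∑ i ∈ Finset.range t, a i : ℕ) : ℝ) ≤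
      kappaOne * t + Real.log t / Real.log 2 + C) (R : ℝ) :
    ∃ T, ∀ t ≥ T, R * 2 ^ (∑ i ∈ Finset.range (t + 1), a i) ≤
      (convergent a (t + 1)).2 * (convergent a (t + 2)).2 := by
  have hφ := goldenRatio_pos
  -- Bounded excess: 2^S is of order 2^t, negligible against φ^(2t).
  by_cases hb : ∃ B, ∀ t, excess a t ≤ B
  · obtain ⟨B, hB⟩ := hb
    obtain ⟨T, hT⟩ := Filter.eventually_atTop.1
      (eventually_mul_two_pow_le (|R| * goldenRatio ^ 7) B)
    refine ⟨T, fun t ht => ?_⟩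
    have h1 := hT (t + 1) (by omega)
    have h2 := goldenRatio_pow_le_den_mul_den ha t
    have h3 : (1 : ℝ) ≤ (1 + excess a t) * (1 + excess a (t + 1)) := by
      have : (0 : ℝ) ≤ excess a t := Nat.cast_nonneg _
      have : (0 : ℝ) ≤ excess a (t + 1) := Nat.cast_nonneg _
      nlinarith
    have h4 : goldenRatio ^ 7 * (R * 2 ^ (∑ i ∈ Finset.range (t + 1), a i)) ≤
        goldenRatio ^ 7 * ((convergent a (t + 1)).2 * (convergent a (t + 2)).2) := by
      calc goldenRatio ^ 7 * (R * 2 ^ (∑ i ∈ Finset.range (t + 1), a i))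
          ≤ goldenRatio ^ 7 * (|R| * 2 ^ (B + (t + 1))) := by
            gcongr
            · exact le_abs_self R
            · exact one_le_two
            · rw [sum_eq_add_excess ha]; linarith [hB (t + 1)]
        _ = |R| * goldenRatio ^ 7 * 2 ^ (B + (t + 1)) := by ring
        _ ≤ goldenRatio ^ (2 * (t + 1)) := h1
        _ ≤ _ := le_mul_of_one_le_right (by positivity) h3
        _ ≤ _ := h2
    exact le_of_mul_le_mul_left h4 (by positivity)
  · push Not at hb
    have hκ := sub_pos.2 one_lt_kappaOne
    have hK : (0 : ℝ) < 2 ^ C := by positivity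
    obtain ⟨B, hB⟩ := exists_nat_ge (|R| * goldenRatio ^ 7 * 2 ^ C / (kappaOne - 1))
    obtain ⟨T, hT⟩ := hb B
    refine ⟨T, fun t ht => ?_⟩
    have hE : (B : ℝ) ≤ excess a t := by
      exact_mod_cast hT.le.trans (excess_mono a ht)
    have hs : (0 : ℝ) < ((t + 1 : ℕ) : ℝ) := by positivity
    have hlog : 0 ≤ Real.log ((t + 1 : ℕ) : ℝ) / Real.log 2 :=
      div_nonneg (Real.log_natCast_nonneg _) (Real.log_nonneg one_le_two)
    set β := kappaOne * ((t + 1 : ℕ) : ℝ) + Real.log ((t + 1 : ℕ) : ℝ) / Real.log 2 + C with hβ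
    have hβ0 : ((t + 1 : ℕ) : ℝ) ≤ β := by nlinarith [one_lt_kappaOne]
    have hfl := Nat.floor_le (hs.le.trans hβ0)
    have hfl' := Nat.lt_floor_add_one β
    have hle := Nat.le_floor (hC (t + 1) (by omega))
    rw [← hβ, sum_eq_add_excess ha] at hle
    -- `F` is the largest excess the hypothesis allows at `t + 1`; as κ₁ > 1, it grows at least
    -- linearly (`h2`).
    obtain ⟨F, hF⟩ := Nat.exists_eq_add_of_le (Nat.le_floor hβ0)
    have hEF : excess a (t + 1) ≤ F := by omega
    have h1 : (2 : ℝ) ^ (t + 1 + F) ≤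
        goldenRatio ^ (2 * (t + 1)) * ((t + 1 : ℕ) : ℝ) * 2 ^ C := by
      rw [← two_rpow_kappaOne_mul, ← Real.rpow_natCast, ← hF]
      nth_rw 2 [← two_rpow_log_div hs]
      rw [← Real.rpow_add two_pos, ← Real.rpow_add two_pos]
      exact Real.rpow_le_rpow_of_exponent_le one_le_two hfl
    have h2 : (kappaOne - 1) * ((t + 1 : ℕ) : ℝ) ≤ F + 1 := by
      rw [hF] at hfl'
      have : ((t + 1 + F : ℕ) : ℝ) = ((t + 1 : ℕ) : ℝ) + F := by push_cast; ring
      rw [this] at hfl'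
      linarith
    -- The factor `1 + excess a (t + 1)` pays for the logarithmic term; the unbounded `1 + excess a
    -- t` is kept to beat `R`.
    have h3 : (kappaOne - 1) * 2 ^ (t + 1 + excess a (t + 1)) ≤
        (1 + excess a (t + 1)) * (goldenRatio ^ (2 * (t + 1)) * 2 ^ C) := by
      refine le_of_mul_le_mul_left ?_ hs
      calc ((t + 1 : ℕ) : ℝ) * ((kappaOne - 1) * 2 ^ (t + 1 + excess a (t + 1)))
          = ((kappaOne - 1) * ((t + 1 : ℕ) : ℝ)) * 2 ^ excess a (t + 1) * 2 ^ (t + 1) := by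
            rw [pow_add _ (t + 1)]; ring
        _ ≤ (F + 1) * 2 ^ excess a (t + 1) * 2 ^ (t + 1) := by gcongr
        _ ≤ (excess a (t + 1) + 1) * 2 ^ F * 2 ^ (t + 1) :=
            mul_le_mul_of_nonneg_right (succ_mul_two_pow_le hEF) (by positivity)
        _ = (excess a (t + 1) + 1) * 2 ^ (t + 1 + F) := by rw [pow_add _ (t + 1) F]; ring
        _ ≤ (excess a (t + 1) + 1) *
            (goldenRatio ^ (2 * (t + 1)) * ((t + 1 : ℕ) : ℝ) * 2 ^ C) := by gcongr
        _ = _ := by ring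
    have h4 : |R| * goldenRatio ^ 7 * 2 ^ C ≤ (kappaOne - 1) * (1 + excess a t) := by
      rw [div_le_iff₀ hκ] at hB
      nlinarith
    have h5 := goldenRatio_pow_le_den_mul_den ha t
    rw [sum_eq_add_excess ha]
    refine le_of_mul_le_mul_left ?_ (show 0 < goldenRatio ^ 7 * 2 ^ C by positivity)
    calc goldenRatio ^ 7 * 2 ^ C * (R * 2 ^ (t + 1 + excess a (t + 1)))
        ≤ goldenRatio ^ 7 * 2 ^ C * (|R| * 2 ^ (t + 1 + excess a (t + 1))) := by
          gcongr; exact le_abs_self R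
      _ = (|R| * goldenRatio ^ 7 * 2 ^ C) * 2 ^ (t + 1 + excess a (t + 1)) := by ring
      _ ≤ ((kappaOne - 1) * (1 + excess a t)) * 2 ^ (t + 1 + excess a (t + 1)) := by gcongr
      _ = (1 + excess a t) * ((kappaOne - 1) * 2 ^ (t + 1 + excess a (t + 1))) := by ring
      _ ≤ (1 + excess a t) * ((1 + excess a (t + 1)) * (goldenRatio ^ (2 * (t + 1)) * 2 ^ C)) :=
          mul_le_mul_of_nonneg_left h3 (by positivity)
      _ = 2 ^ C * (goldenRatio ^ (2 * (t + 1)) * ((1 + excess a t) * (1 + excess a (t + 1)))) := by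
          ring
      _ ≤ 2 ^ C * (goldenRatio ^ 7 * ((convergent a (t + 1)).2 * (convergent a (t + 2)).2)) :=
          mul_le_mul_of_nonneg_left h5 hK.le
      _ = _ := by ring

lemma IsCFExpansion.partialQuotientSum (h : IsCFExpansion a θ) (t : ℕ) :
    partialQuotientSum (θ 0) t = ((∑ i ∈ Finset.range t, a i : ℕ) : ℝ) := by
  rw [MinkowskiQM.partialQuotientSum, Nat.cast_sum]
  exact Finset.sum_congr rfl fun i _ => h.partialQuotient i

/-- A sufficient condition for `?'(x) = +∞`. -/
theorem hasExtDerivAt_top_of_partialQuotientSum_le {x : ℝ} (h01 : x ∈ Set.Ioo (0 : ℝ) 1)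
    (hx : Irrational x) {C : ℝ} (hC : ∀ t : ℕ, 1 ≤ t →
      partialQuotientSum x t ≤ kappaOne * (t : ℝ) + Real.log (t : ℝ) / Real.log 2 + C) :
    HasExtDerivAt questionMark ⊤ x := by
  obtain ⟨a, θ, h, rfl⟩ := exists_isCFExpansion_of_irrational hx h01
  refine h.hasExtDerivAt_top (exists_two_pow_le_den_mul_den h.pos (le_max_right C 0) ?_)
  intro t ht
  have := hC t ht
  rw [h.partialQuotientSum] at this
  linarith [le_max_left C 0]

/-! ### Part (ii): construction of the jump sequence -/

variable {ψ : ℕ → ℝ}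

/-- A sequence may be defined by recursion on its partial sums and products. -/
lemma exists_seq_of_sum_prod (D : ℕ → ℕ → ℕ → ℕ) : ∃ a : ℕ → ℕ, ∀ t,
    a t = D t (∑ i ∈ Finset.range t, a i) (∏ i ∈ Finset.range t, a i) := by
  let st : ℕ → ℕ × ℕ := fun t => Nat.rec (0, 1)
    (fun t s => (s.1 + D t s.1 s.2, s.2 * D t s.1 s.2)) t
  have hst : ∀ t, st (t + 1) = ((st t).1 + D t (st t).1 (st t).2,
    (st t).2 * D t (st t).1 (st t).2) := fun t => rfl
  have key : ∀ t, st t = (∑ i ∈ Finset.range t, D i (st i).1 (st i).2,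
      ∏ i ∈ Finset.range t, D i (st i).1 (st i).2) := by
    intro t
    induction t with
    | zero => rfl
    | succ t ih =>
      rw [hst, Finset.sum_range_succ, Finset.prod_range_succ]
      exact Prod.ext (congrArg (· + D t (st t).1 (st t).2) (congrArg Prod.fst ih))
        (congrArg (· * D t (st t).1 (st t).2) (congrArg Prod.snd ih))
  refine ⟨fun t => D t (st t).1 (st t).2, fun t => ?_⟩
  dsimp only
  conv_lhs => rw [key t]

/-- `κ₁ t + log t / log 2 + ψ t`. -/
noncomputable def sumBound (ψ : ℕ → ℝ) (t : ℕ) : ℝ :=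
  kappaOne * (t : ℝ) + Real.log (t : ℝ) / Real.log 2 + ψ t

/-- Since κ₁ > 1, a partial quotient equal to 1 never breaks the bound. -/
lemma sumBound_add_one_le (hψ : MonotoneOn ψ (Set.Ici 1)) {t : ℕ} (ht : 1 ≤ t) :
    sumBound ψ t + 1 ≤ sumBound ψ (t + 1) := by
  have h1 : Real.log t / Real.log 2 ≤ Real.log ((t + 1 : ℕ) : ℝ) / Real.log 2 := by
    have := Real.log_pos one_lt_two
    gcongr
    omega
  have h2 := hψ (Set.mem_Ici.2 ht) (Set.mem_Ici.2 (by omega : 1 ≤ t + 1)) (Nat.le_succ t)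
  have h3 := one_lt_kappaOne
  unfold sumBound
  push_cast at *
  linarith

/-- The conditions under which the partial sum `S` of `t` partial quotients, with product `P`,
may be raised to `⌊sumBound ψ (t + 1)⌋₊` by the next partial quotient. -/
def JumpCond (ψ : ℕ → ℝ) (t S P : ℕ) : Prop :=
  (P : ℝ) ^ 3 * ⌊sumBound ψ (t + 1)⌋₊ * Real.goldenRatio ^ (2 * (t + 1)) ≤
      2 ^ ⌊sumBound ψ (t + 1)⌋₊ ∧
    (P : ℝ) * 2 ^ S ≤ Real.goldenRatio ^ (2 * t) ∧ S + 2 ≤ ⌊sumBound ψ (t + 1)⌋₊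

/-- Applied with `y = ψ (t + 1)`: the unbounded ψ must outweigh the factor that the large quotient
contributes to the next denominator. -/
lemma eventually_linear_le_two_rpow (c K : ℝ) :
    ∀ᶠ y : ℝ in .atTop, K * (c + y) ≤ 2 ^ y := by
  have hl := Real.log_pos one_lt_two
  filter_upwards [Filter.eventually_ge_atTop |c|, Filter.eventually_ge_atTop (0 : ℝ),
    Filter.eventually_ge_atTop (4 * |K| / Real.log 2 ^ 2)] with y h1 h0 h2
  rw [div_le_iff₀ (by positivity)] at h2
  have h3 := Real.quadratic_le_exp_of_nonneg (x := Real.log 2 * y) (by positivity)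
  rw [Real.rpow_def_of_pos two_pos]
  have h4 : K * (c + y) ≤ |K| * (|c| + y) := by
    have := le_abs_self c
    calc K * (c + y) ≤ |K| * |c + y| := by rw [← abs_mul]; exact le_abs_self _
      _ ≤ |K| * (|c| + |y|) := by gcongr; exact abs_add_le c y
      _ = _ := by rw [abs_of_nonneg h0]
  have h5 : |K| * (|c| + y) ≤ |K| * (2 * y) := by gcongr; linarith
  have h6 : 4 * |K| * y ≤ y * Real.log 2 ^ 2 * y := by gcongr
  have h7 : 0 ≤ Real.log 2 * y := by positivity
  nlinarith

/-- The clauses of `JumpCond` give, in turn, a slope at most 2/P after the jump, a slope at least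
P/φ^6 before it, and a new quotient at least 2. For fixed `P` all hold eventually: 2^(sumBound) is
φ^(2(t+1)) (t+1) 2^ψ, whereas the integer part is at most (t+1)(κ₁ + 1 + ψ). -/
lemma eventually_jumpCond (hψ : Filter.Tendsto ψ .atTop .atTop) (S P : ℕ) :
    ∀ᶠ t in .atTop, ∀ S' ≤ S + t, JumpCond ψ t S' P := by
  have hs : Filter.Tendsto (fun t => ψ (t + 1)) .atTop .atTop :=
    (Filter.tendsto_add_atTop_iff_nat 1).2 hψ
  filter_upwards [hs.eventually (eventually_linear_le_two_rpow (kappaOne + 1) (2 * P ^ 3)),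
    hs.eventually_ge_atTop ((S : ℝ) + 2), eventually_mul_two_pow_le P S] with t h1 h2 h3 S' hS'
  have hκ := one_lt_kappaOne
  have ht : (1 : ℝ) ≤ ((t + 1 : ℕ) : ℝ) := by exact_mod_cast Nat.succ_le_succ (Nat.zero_le t)
  have ht0 : (0 : ℝ) < ((t + 1 : ℕ) : ℝ) := by linarith
  have hlog : 0 ≤ Real.log ((t + 1 : ℕ) : ℝ) / Real.log 2 :=
    div_nonneg (Real.log_natCast_nonneg _) (Real.log_nonneg one_le_two)
  have hlog' : Real.log ((t + 1 : ℕ) : ℝ) / Real.log 2 ≤ ((t + 1 : ℕ) : ℝ) := by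
    rw [← Real.rpow_le_rpow_left_iff one_lt_two, two_rpow_log_div ht0, Real.rpow_natCast]
    exact_mod_cast Nat.lt_two_pow_self.le
  have hS0 : (0 : ℝ) ≤ S := Nat.cast_nonneg _
  have hψ0 : 0 ≤ ψ (t + 1) := by linarith
  have hB : (S : ℝ) + t + 2 ≤ sumBound ψ (t + 1) := by
    unfold sumBound
    have : ((t + 1 : ℕ) : ℝ) ≤ kappaOne * ((t + 1 : ℕ) : ℝ) := by nlinarith
    push_cast at *
    linarith
  have hB0 : 0 ≤ sumBound ψ (t + 1) := by
    have : (0 : ℝ) ≤ t := Nat.cast_nonneg _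
    linarith
  refine ⟨?_, ?_, ?_⟩
  · have hfl := Nat.floor_le hB0
    have hfl' := Nat.lt_floor_add_one (sumBound ψ (t + 1))
    have e : (2 : ℝ) ^ sumBound ψ (t + 1) =
        Real.goldenRatio ^ (2 * (t + 1)) * ((t + 1 : ℕ) : ℝ) * 2 ^ ψ (t + 1) := by
      rw [sumBound, Real.rpow_add two_pos, Real.rpow_add two_pos, two_rpow_kappaOne_mul,
        two_rpow_log_div ht0]
    have h4 : (2 : ℝ) ^ sumBound ψ (t + 1) ≤ 2 * 2 ^ ⌊sumBound ψ (t + 1)⌋₊ := by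
      rw [← pow_succ', ← Real.rpow_natCast]
      apply Real.rpow_le_rpow_of_exponent_le one_le_two
      push_cast
      exact hfl'.le
    have h5 : (⌊sumBound ψ (t + 1)⌋₊ : ℝ) ≤
        ((t + 1 : ℕ) : ℝ) * (kappaOne + 1 + ψ (t + 1)) := by
      refine hfl.trans ?_
      unfold sumBound
      nlinarith
    have hP : (0 : ℝ) ≤ P ^ 3 := by positivity
    have hφ : 0 < Real.goldenRatio ^ (2 * (t + 1)) := pow_pos Real.goldenRatio_pos _
    generalize Real.goldenRatio ^ (2 * (t + 1)) = G at *
    generalize (2 : ℝ) ^ ⌊sumBound ψ (t + 1)⌋₊ = Q at *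
    generalize (⌊sumBound ψ (t + 1)⌋₊ : ℝ) = F at *
    generalize ((t + 1 : ℕ) : ℝ) = s at *
    have h6 : 2 * (P ^ 3 * F * G) ≤ 2 * Q := by
      calc 2 * (P ^ 3 * F * G) ≤ 2 * (P ^ 3 * (s * (kappaOne + 1 + ψ (t + 1))) * G) := by gcongr
        _ = G * s * (2 * P ^ 3 * (kappaOne + 1 + ψ (t + 1))) := by ring
        _ ≤ G * s * 2 ^ ψ (t + 1) := by gcongr
        _ = _ := e.symm
        _ ≤ _ := h4
    linarith
  · refine le_trans ?_ h3
    gcongr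
    exact one_le_two
  · apply Nat.le_floor
    have : (S' : ℝ) ≤ S + t := by exact_mod_cast hS'
    push_cast
    linarith

/-- The partial quotients obey the rule: raise the sum to `⌊sumBound ψ⌋₊` when `JumpCond` holds,
and take `1` otherwise. -/
structure IsJumpSeq (ψ : ℕ → ℝ) (a : ℕ → ℕ) : Prop where
  jump : ∀ t, JumpCond ψ t (∑ i ∈ Finset.range t, a i) (∏ i ∈ Finset.range t, a i) →
    ∑ i ∈ Finset.range (t + 1), a i = ⌊sumBound ψ (t + 1)⌋₊
  stay : ∀ t, ¬ JumpCond ψ t (∑ i ∈ Finset.range t, a i) (∏ i ∈ Finset.range t, a i) → a t = 1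

lemma exists_isJumpSeq (ψ : ℕ → ℝ) : ∃ a, IsJumpSeq ψ a := by
  classical
  obtain ⟨a, ha⟩ := exists_seq_of_sum_prod fun t S P =>
    if JumpCond ψ t S P then ⌊sumBound ψ (t + 1)⌋₊ - S else 1
  refine ⟨a, fun t h => ?_, fun t h => ?_⟩
  · have h1 := ha t
    rw [if_pos h] at h1
    have := h.2.2
    rw [Finset.sum_range_succ]
    omega
  · rw [ha t, if_neg h]

namespace IsJumpSeq

lemma two_le (h : IsJumpSeq ψ a) {t : ℕ}
    (ht : JumpCond ψ t (∑ i ∈ Finset.range t, a i) (∏ i ∈ Finset.range t, a i)) : 2 ≤ a t := by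
  have h1 := h.jump t ht
  have := ht.2.2
  rw [Finset.sum_range_succ] at h1
  omega

lemma one_le (h : IsJumpSeq ψ a) (t : ℕ) : 1 ≤ a t := by
  by_cases ht : JumpCond ψ t (∑ i ∈ Finset.range t, a i) (∏ i ∈ Finset.range t, a i)
  · exact one_le_two.trans (h.two_le ht)
  · exact (h.stay t ht).ge

/-- Without jumps from `T` on, all further quotients are 1: the product is constant and the sum
grows by 1 per step, so `eventually_jumpCond` forces a jump. -/
lemma frequently_jump (h : IsJumpSeq ψ a) (hψ : Filter.Tendsto ψ .atTop .atTop) (T : ℕ) :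
    ∃ t ≥ T, JumpCond ψ t (∑ i ∈ Finset.range t, a i) (∏ i ∈ Finset.range t, a i) := by
  by_contra! hno
  have key : ∀ k, ∑ i ∈ Finset.range (T + k), a i = ∑ i ∈ Finset.range T, a i + k ∧
      ∏ i ∈ Finset.range (T + k), a i = ∏ i ∈ Finset.range T, a i := by
    intro k
    induction k with
    | zero => simp
    | succ k ih =>
      have h1 := h.stay _ (hno (T + k) (by omega))
      rw [← add_assoc, Finset.sum_range_succ, Finset.prod_range_succ, h1, ih.1, ih.2]
      simp [add_assoc]
  obtain ⟨N, hN⟩ := Filter.eventually_atTop.1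
    (eventually_jumpCond hψ (∑ i ∈ Finset.range T, a i) (∏ i ∈ Finset.range T, a i))
  apply hno (T + N) (by omega)
  obtain ⟨h1, h2⟩ := key N
  rw [h1, h2]
  exact hN (T + N) (by omega) _ (by omega)

lemma sum_le_of_jump (h : IsJumpSeq ψ a) {t : ℕ}
    (ht : JumpCond ψ t (∑ i ∈ Finset.range t, a i) (∏ i ∈ Finset.range t, a i)) :
    ((∑ i ∈ Finset.range (t + 1), a i : ℕ) : ℝ) ≤ sumBound ψ (t + 1) := by
  rw [h.jump t ht]
  have h1 := ht.2.2
  -- The natural floor is positive by the third clause, which excludes a negative `sumBound`.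
  exact Nat.floor_le (zero_le_one.trans (Nat.floor_pos.1 (by omega)))

lemma sum_le (h : IsJumpSeq ψ a) (hψ : MonotoneOn ψ (Set.Ici 1)) {T : ℕ} (hT : 1 ≤ T)
    (h0 : ((∑ i ∈ Finset.range T, a i : ℕ) : ℝ) ≤ sumBound ψ T) {t : ℕ} (ht : T ≤ t) :
    ((∑ i ∈ Finset.range t, a i : ℕ) : ℝ) ≤ sumBound ψ t := by
  induction t, ht using Nat.le_induction with
  | base => exact h0
  | succ t ht ih =>
    by_cases hj : JumpCond ψ t (∑ i ∈ Finset.range t, a i) (∏ i ∈ Finset.range t, a i)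
    · exact h.sum_le_of_jump hj
    · rw [Finset.sum_range_succ, h.stay t hj]
      push_cast at ih ⊢
      linarith [sumBound_add_one_le hψ (hT.trans ht)]

end IsJumpSeq

/-! ### Part (ii): oscillation of the slopes -/

/-- Just before a jump the slope of `?` is large. -/
lemma IsCFExpansion.exists_le_cellSlope_of_jumpCond (h : IsCFExpansion a θ) {t : ℕ}
    (ht : JumpCond ψ t (∑ i ∈ Finset.range t, a i) (∏ i ∈ Finset.range t, a i)) :
    ∃ k, InCell (θ 0) (∑ i ∈ Finset.range t, a i) k ∧
      ((∏ i ∈ Finset.range t, a i : ℕ) : ℝ) / Real.goldenRatio ^ 6 ≤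
        cellSlope (∑ i ∈ Finset.range t, a i) k := by
  obtain ⟨k, hk, e⟩ := h.exists_inCell t 0 (h.pos t)
  refine ⟨k, hk, ?_⟩
  rw [add_zero] at e
  rw [e, div_le_div_iff₀ (pow_pos Real.goldenRatio_pos 6) (by positivity)]
  have hφ := Real.goldenRatio_pos
  have h1 : Real.goldenRatio ^ t ≤ Real.goldenRatio ^ 3 * (convergent a (t + 1)).2 := by
    refine le_trans (le_mul_of_one_le_right (by positivity) ?_) (goldenRatio_pow_le_den h.pos t)
    have : (0 : ℝ) ≤ excess a t := Nat.cast_nonneg _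
    linarith
  have h0 : (0 : ℝ) ≤ (convergent a t).2 := Nat.cast_nonneg _
  calc _ ≤ Real.goldenRatio ^ (2 * t) := ht.2.1
    _ = Real.goldenRatio ^ t * Real.goldenRatio ^ t := by rw [two_mul, pow_add]
    _ ≤ (Real.goldenRatio ^ 3 * (convergent a (t + 1)).2) *
        (Real.goldenRatio ^ 3 * (convergent a (t + 1)).2) :=
      mul_le_mul h1 h1 (by positivity) (by positivity)
    _ = (convergent a (t + 1)).2 * (convergent a (t + 1)).2 * Real.goldenRatio ^ 6 := by ring
    _ ≤ _ := by
      gcongr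
      push_cast
      linarith

/-- Just after a jump the slope of `?` is small. -/
lemma IsCFExpansion.exists_cellSlope_le_of_jumpCond (h : IsCFExpansion a θ)
    (hj : IsJumpSeq ψ a) {t : ℕ}
    (ht : JumpCond ψ t (∑ i ∈ Finset.range t, a i) (∏ i ∈ Finset.range t, a i)) :
    ∃ k, InCell (θ 0) (∑ i ∈ Finset.range t, a i + (a t - 1)) k ∧
      cellSlope (∑ i ∈ Finset.range t, a i + (a t - 1)) k ≤
        2 / ((∏ i ∈ Finset.range t, a i : ℕ) : ℝ) := by
  have hpos := h.pos t
  -- The last cell of the run, whose end denominators are two consecutive continuants.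
  obtain ⟨k, hk, e⟩ := h.exists_inCell t (a t - 1) (by omega)
  refine ⟨k, hk, ?_⟩
  have hP : (0 : ℝ) < ((∏ i ∈ Finset.range t, a i : ℕ) : ℝ) := by
    exact_mod_cast Finset.prod_pos fun i _ => h.pos i
  have hφ := Real.goldenRatio_pos
  rw [Nat.cast_sub hpos, Nat.cast_one, sub_add_cancel, ← convergent_den_succ] at e
  rw [e, div_le_div_iff₀ (by positivity) hP]
  have h1 := den_le_goldenRatio_pow h.pos t
  have h2 := den_le_goldenRatio_pow h.pos (t + 1)
  have h3 := ht.1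
  rw [← hj.jump t ht] at h3
  have h4 : (a t : ℝ) ≤ ((∑ i ∈ Finset.range (t + 1), a i : ℕ) : ℝ) := by
    rw [Finset.sum_range_succ]; exact_mod_cast Nat.le_add_left _ _
  rw [Finset.prod_range_succ, Nat.cast_mul] at h2
  have e2 : (2 : ℝ) * 2 ^ (∑ i ∈ Finset.range t, a i + (a t - 1)) =
      2 ^ (∑ i ∈ Finset.range (t + 1), a i) := by
    rw [← pow_succ', Finset.sum_range_succ]; congr 1; omega
  rw [e2]
  refine le_trans ?_ h3
  generalize ((∏ i ∈ Finset.range t, a i : ℕ) : ℝ) = P at *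
  generalize ((∑ i ∈ Finset.range (t + 1), a i : ℕ) : ℝ) = S at *
  -- Two of the factors `P` bound the denominators; the third is what turns the bound into 2/P.
  calc ((convergent a (t + 1)).2 : ℝ) * (convergent a (t + 2)).2 * P
      ≤ (Real.goldenRatio ^ t * P) * (Real.goldenRatio ^ (t + 1) * (P * a t)) * P := by gcongr
    _ = P ^ 3 * a t * Real.goldenRatio ^ (2 * t + 1) := by ring
    _ ≤ P ^ 3 * S * Real.goldenRatio ^ (2 * (t + 1)) := by
      have : Real.goldenRatio ^ (2 * t + 1) ≤ Real.goldenRatio ^ (2 * (t + 1)) :=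
        pow_le_pow_right₀ Real.one_lt_goldenRatio.le (by omega)
      have hS : 0 ≤ S := (Nat.cast_nonneg (a t)).trans h4
      gcongr

theorem IsCFExpansion.not_hasExtDerivAt (h : IsCFExpansion a θ) (hj : IsJumpSeq ψ a)
    (hψ : Filter.Tendsto ψ .atTop .atTop) : ¬ ∃ L, HasExtDerivAt questionMark L (θ 0) := by
  rintro ⟨L, hL⟩
  obtain ⟨s, hs, hjump⟩ := Filter.extraction_of_frequently_atTop
    (Filter.frequently_atTop.2 fun T => hj.frequently_jump hψ T)
  -- Each jump contributes a quotient at least 2 and no quotient is below 1, so the product is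
  -- unbounded along the jumps.
  have hP : ∀ k, k + 1 ≤ ∏ i ∈ Finset.range (s k), a i := by
    intro k
    induction k with
    | zero => exact Nat.one_le_iff_ne_zero.2 (Finset.prod_pos fun i _ => h.pos i).ne'
    | succ k ih =>
      have h1 : ∏ i ∈ Finset.range (s k + 1), a i ≤ ∏ i ∈ Finset.range (s (k + 1)), a i :=
        Finset.prod_le_prod_of_subset_of_one_le' (Finset.range_mono (hs (Nat.lt_succ_self k)))
          fun i _ _ => h.pos i
      rw [Finset.prod_range_succ] at h1
      have := hj.two_le (hjump k)
      nlinarith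
  have hP' : ∀ k : ℕ, (k : ℝ) + 1 ≤ ((∏ i ∈ Finset.range (s k), a i : ℕ) : ℝ) := fun k => by
    exact_mod_cast hP k
  have hS : ∀ k, k ≤ ∑ i ∈ Finset.range (s k), a i := fun k => by
    rw [sum_eq_add_excess h.pos]
    have := hs.id_le k
    simp only [id] at this
    omega
  choose c hc hc' using fun k => h.exists_le_cellSlope_of_jumpCond (hjump k)
  choose d hd hd' using fun k => h.exists_cellSlope_le_of_jumpCond hj (hjump k)
  have lim1 := hL.tendsto_cellSlope h.irrational
    (Filter.tendsto_atTop_mono hS Filter.tendsto_id) hc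
  have lim2 := hL.tendsto_cellSlope h.irrational
    (Filter.tendsto_atTop_mono (fun k => (hS k).trans (Nat.le_add_right _ _)) Filter.tendsto_id) hd
  have top : Filter.Tendsto (fun k => (cellSlope (∑ i ∈ Finset.range (s k), a i) (c k) : EReal))
      .atTop (nhds ⊤) := by
    rw [EReal.tendsto_coe_nhds_top_iff]
    have hφ := pow_pos Real.goldenRatio_pos 6
    refine Filter.tendsto_atTop_mono (fun k => le_trans ?_ (hc' k))
      (tendsto_natCast_atTop_atTop.atTop_div_const hφ)
    exact div_le_div_of_nonneg_right (by linarith [hP' k]) hφ.le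
  have zero : Filter.Tendsto
      (fun k => (cellSlope (∑ i ∈ Finset.range (s k), a i + (a (s k) - 1)) (d k) : EReal))
      .atTop (nhds ((0 : ℝ) : EReal)) := by
    rw [EReal.tendsto_coe]
    have lim : Filter.Tendsto (fun k : ℕ => 2 * (1 / ((k : ℝ) + 1))) .atTop (nhds 0) := by
      simpa using tendsto_one_div_add_atTop_nhds_zero_nat.const_mul (2 : ℝ)
    refine squeeze_zero (fun k => ?_) (fun k => (hd' k).trans ?_) lim
    · unfold cellSlope; positivity
    · rw [mul_one_div]
      have := hP' k
      gcongr
  rw [tendsto_nhds_unique lim1 top] at lim2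
  exact EReal.coe_ne_top 0 (tendsto_nhds_unique zero lim2)

end MinkowskiQM

theorem theorem1 :
    (∀ x : ℝ, x ∈ Set.Ioo (0 : ℝ) 1 → Irrational x →
      (∃ C : ℝ, ∀ t : ℕ, 1 ≤ t →
        MinkowskiQM.partialQuotientSum x t ≤
          MinkowskiQM.kappaOne * (t : ℝ) + Real.log (t : ℝ) / Real.log 2 + C) →
      MinkowskiQM.HasExtDerivAt MinkowskiQM.questionMark ⊤ x) ∧
    (∀ ψ : ℕ → ℝ, MonotoneOn ψ (Set.Ici 1) → Filter.Tendsto ψ Filter.atTop Filter.atTop →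
      ∃ x : ℝ, x ∈ Set.Ioo (0 : ℝ) 1 ∧ Irrational x ∧
        (¬ ∃ L : EReal, MinkowskiQM.HasExtDerivAt MinkowskiQM.questionMark L x) ∧
        (∃ T : ℕ, ∀ t : ℕ, T ≤ t →
          MinkowskiQM.partialQuotientSum x t ≤
            MinkowskiQM.kappaOne * (t : ℝ) + Real.log (t : ℝ) / Real.log 2 + ψ t) ∧
        (1 - MinkowskiQM.kappaOne ≤ ψ 1 → ∀ t : ℕ, 1 ≤ t →
          MinkowskiQM.partialQuotientSum x t ≤
            MinkowskiQM.kappaOne * (t : ℝ) + Real.log (t : ℝ) / Real.log 2 + ψ t)) := by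
  refine ⟨fun x h01 hx ⟨C, hC⟩ =>
    MinkowskiQM.hasExtDerivAt_top_of_partialQuotientSum_le h01 hx hC, fun ψ hmono hψ => ?_⟩
  obtain ⟨a, hj⟩ := MinkowskiQM.exists_isJumpSeq ψ
  obtain ⟨θ, h⟩ := MinkowskiQM.exists_isCFExpansion hj.one_le
  refine ⟨θ 0, h.mem 0, h.irrational, h.not_hasExtDerivAt hj hψ, ?_, fun h1 t ht => ?_⟩
  -- ψ may be very negative at first, so the bound is started at a jump, where it holds by
  -- construction.
  · obtain ⟨t, -, ht⟩ := hj.frequently_jump hψ 0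
    refine ⟨t + 1, fun u hu => ?_⟩
    rw [h.partialQuotientSum]
    exact hj.sum_le hmono (Nat.le_add_left 1 t) (hj.sum_le_of_jump ht) hu
  · rw [h.partialQuotientSum]
    refine hj.sum_le hmono le_rfl ?_ ht
    -- Without a jump at 0 the first quotient is 1, and the assumption on `ψ 1` says precisely that
    -- `sumBound ψ 1` is at least 1.
    by_cases h0 : MinkowskiQM.JumpCond ψ 0 (∑ i ∈ Finset.range 0, a i) (∏ i ∈ Finset.range 0, a i)
    · exact hj.sum_le_of_jump h0
    · simp only [Finset.sum_range_one, hj.stay 0 h0, MinkowskiQM.sumBound, Nat.cast_one,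
        Real.log_one, zero_div]
      linarith
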